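/- **Setting.** Let $A\ge 1$. Let $(u,v,n)$ be an orthonormal basis of $\mathbb R^3$ and let $\Gamma=\{\gamma(s)=su+\varphi(s)v+hn:\ s\in[a,b]\}\subset \overline{B}(0,1)$ be a planar $C^2$ curve with $|\varphi'|\le A$ and $A^{-1}\le\varphi''\le A$ on $[a,b]$. Let $\Gamma_1,\Gamma_2\subset\Gamma$ be sub-curves (images of subintervals of $[a,b]$) with $\mathrm{dist}(\Gamma_1,\Gamma_2)\ge A^{-1}$. Let $\delta>0$, $0<p\le 4$, $R\ge1$, $R^{1/2}\le\rho\le R$. Let $g_1,g_2\in L^2(\mathbb R^3)$ have Fourier transforms supported in the closed $R^{-1}$-neighbourhoods of $\Gamma_1,\Gamma_2$ respectively. Let $S=\{x:|\langle n,x\rangle-c|\le\rho\}\cap \overline{B}(x_0,R)$ be the part in an $R$-ball of the $\rho$-neighbourhood of a plane parallel to $\Gamma$. *Wave packets.* Fix a smooth $\psi:\mathbb R\to[0,1]$ supported in $[-1,1]$ with $\sum_{k\in\mathbb Z}\psi(\cdot-k)=1$, and a Schwartz function $\eta_0$ on $\mathbb R^2$ whose Fourier transform is supported in the closed unit disc,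 with $\sum_{m\in\mathbb Z^2}\eta_0(\cdot-m)=1$. For $k\in\mathbb Z$ let $s_k$ be the point of $[a,b]$ closest to $k/\rho$, let $\tau_k$ be the unit tangent of $\Gamma$ at $\gamma(s_k)$, and put $\pi_k(x)=\rho^{-1}(\langle\tau_k,x\rangle,\langle n,x\rangle)\in\mathbb R^2$. For an index $(k,m)\in\mathbb Z\times\mathbb Z^2$ the corresponding planar tube in $S$ is $T=T_{k,m}=\{x\in S:|\pi_k(x)-m|\le R^{\delta}\}$, whose axis is normal to $\Gamma$ in its plane at $\gamma(s_k)$, and the corresponding wave packet of $g_j$ is $$g_{j,T}(x)=\eta_0(\pi_k(x)-m)\,\big(\psi(\rho\langle u,\cdot\rangle-k)\,\widehat{g_j}\big)^{\vee}(x).$$ Let $\mathbb T_1,\mathbb T_2$ be finite sets of tubes (indices) such that, for $j=1,2$, $g_j=\sum_{T\in\mathbb T_j}g_{j,T}$ on $S$ up to rapidly decaying tails: for every $N\in\mathbb N$, $|g_j-\sum_{T\in\mathbb T_j}g_{j,T}|\le D_NR^{-N}\|g_j\|_2$ almost everywhere on $S$, for a fixed sequence $(D_N)$. *Balls.* Let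 $\mathcal Q$ be a finite collection of disjoint balls of radius $\rho$ contained in $S$, and let $F:\mathcal Q\to[0,\infty)$ satisfy $F(Q)\le R^{\delta}F(Q')$ for all $Q,Q'\in\mathcal Q$ and $F(Q)\le\int_Q|g_1g_2|^{p/2}$ for all $Q\in\mathcal Q$. *Uniform incidence.* Let $\eta\ge1$ be such that $A^{-1}\eta\le|\{Q\in\mathcal Q:Q\cap T\ne\varnothing\}|\le A\eta$ for every $T\in\mathbb T_1\cup\mathbb T_2$. **Lemma.** There are an absolute constant $K>0$ and a constant $C>0$ depending only on $A,p,\delta,\psi,\eta_0$ and $(D_N)$ (in particular not on $R,\rho,\eta,\Gamma,\Gamma_1,\Gamma_2,g_1,g_2,S,\mathcal Q,F,\mathbb T_1,\mathbb T_2$) such that $$\sum_{Q\in\mathcal Q}F(Q)\le C\,R^{K\delta}\,\rho^{3-p}R^{-p/2}\,|\mathcal Q|^{1-p/2}\min\{|\mathcal Q|^{p/4},\eta^{p/2}\}\,\|g_1\|_2^{p/2}\|g_2\|_2^{p/2}.$$ -/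

import Mathlib

open MeasureTheory Metric Set
open scoped FourierTransform SchwartzMap ContDiff InnerProductSpace

noncomputable section

namespace PlanarBilinear

/-- Euclidean three-space. -/
abbrev E3 := EuclideanSpace ℝ (Fin 3)

/-- The Euclidean plane. -/
abbrev E2 := EuclideanSpace ℝ (Fin 2)

/-- Data of a truncated planar curve in `ℝ³`: in the coordinates of an orthonormal frame
`(u, v, n)` it is the graph `{s u + φ(s) v + h n : s ∈ [a, b]}`, lying in a plane with
unit normal `n`. -/
structure PlanarCurve where
  frame : OrthonormalBasis (Fin 3) ℝ E3
  height : ℝ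
  φ : ℝ → ℝ
  a : ℝ
  b : ℝ

namespace PlanarCurve

variable (Γ : PlanarCurve)

/-- The point of the curve with graph parameter `s`. -/
def point (s : ℝ) : E3 :=
  s • Γ.frame 0 + Γ.φ s • Γ.frame 1 + Γ.height • Γ.frame 2

/-- The unit normal of the plane containing the curve. -/
def planeNormal : E3 := Γ.frame 2

/-- The unit tangent of the curve at the parameter `s`. -/
def tangent (s : ℝ) : E3 :=
  (Real.sqrt (1 + deriv Γ.φ s ^ 2))⁻¹ • (Γ.frame 0 + deriv Γ.φ s • Γ.frame 1)

/-- The curve lies in the unit ball, is `C²`, and has positive curvature, quantitatively: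
`|φ'| ≤ A` and `A⁻¹ ≤ φ'' ≤ A` on `[a, b]`. -/
structure IsCurved (A : ℝ) : Prop where
  le : Γ.a ≤ Γ.b
  subset_ball : ∀ s ∈ Icc Γ.a Γ.b, Γ.point s ∈ closedBall (0 : E3) 1
  contDiff : ContDiff ℝ 2 Γ.φ
  abs_deriv_le : ∀ s ∈ Icc Γ.a Γ.b, |deriv Γ.φ s| ≤ A
  le_deriv2 : ∀ s ∈ Icc Γ.a Γ.b, A⁻¹ ≤ deriv (deriv Γ.φ) s
  deriv2_le : ∀ s ∈ Icc Γ.a Γ.b, deriv (deriv Γ.φ) s ≤ A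

/-- The sub-curve with parameters in `[s, t]`. -/
def arc (s t : ℝ) : Set E3 := Γ.point '' Icc s t

/-- `N_ρ(P) ∩ B_R`, where `P = {x : ⟪n, x⟫ = c}` is a plane parallel to the curve and `B_R` is
the ball of radius `R` about `x₀`. -/
def slab (ρ R c : ℝ) (x₀ : E3) : Set E3 :=
  {x | |⟪Γ.planeNormal, x⟫_ℝ - c| ≤ ρ} ∩ closedBall x₀ R

/-- The parameter in `[a, b]` closest to `k / ρ`: the base point of the `k`-th arc of
length about `ρ⁻¹`. -/
def node (ρ : ℝ) (k : ℤ) : ℝ := max Γ.a (min Γ.b (k / ρ))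

/-- The coordinates of `x`, in units of `ρ`, in the two directions transversal to the `k`-th
family of tubes: the tangent of the curve at the `k`-th node, and the normal of the plane.
The tubes of this family point in the third direction, which is normal to the curve inside
the plane. -/
def crossCoord (ρ : ℝ) (k : ℤ) (x : E3) : E2 :=
  !₂[⟪Γ.tangent (Γ.node ρ k), x⟫_ℝ / ρ, ⟪Γ.planeNormal, x⟫_ℝ / ρ]

end PlanarCurve

/-- The lattice point of the plane with integer coordinates `m`. -/
def latticePoint (m : ℤ × ℤ) : E2 := !₂[(m.1 : ℝ), (m.2 : ℝ)]

/-- The two fixed bump functions from which wave packets are made: a smooth compactly supported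
`ψ` whose integer translates form a partition of unity of the line (used in frequency), and a
Schwartz function `η` with compactly supported Fourier transform whose integer translates form a
partition of unity of the plane (used in space). -/
structure WavePacketProfile where
  ψ : ℝ → ℝ
  ψ_smooth : ContDiff ℝ ∞ ψ
  ψ_mem : ∀ t, ψ t ∈ Icc (0 : ℝ) 1
  ψ_support : ∀ t, 1 < |t| → ψ t = 0
  ψ_sum : ∀ t, HasSum (fun k : ℤ => ψ (t - k)) 1
  η : 𝓢(E2, ℂ)
  η_fourier : ∀ ζ, 1 < ‖ζ‖ → 𝓕 η ζ = 0
  η_sum : ∀ y, HasSum (fun m : ℤ × ℤ => η (y - latticePoint m)) 1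

/-- Index of a planar tube or wave packet: the number `k` of its direction, and the position
`m ∈ ℤ²` (in units of `ρ`) of its axis. -/
abbrev TubeIndex := ℤ × (ℤ × ℤ)

/-- The planar tube of index `(k, m)` in the slab: the points of the slab within distance
`ρ R^δ` of the axis. -/
def tube (Γ : PlanarCurve) (ρ R δ : ℝ) (S : Set E3) (T : TubeIndex) : Set E3 :=
  {x ∈ S | ‖Γ.crossCoord ρ T.1 x - latticePoint T.2‖ ≤ R ^ δ}

/-- The frequency piece `(ψ_k ĝ)^∨`, with `ψ_k(ξ) = ψ(ρ ⟪u, ξ⟫ - k)`. It is used for `g` with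
compactly supported Fourier transform, so that the inverse Fourier integral converges. -/
def freqPiece (W : WavePacketProfile) (Γ : PlanarCurve) (ρ : ℝ) (k : ℤ)
    (g : Lp ℂ 2 (volume : Measure E3)) : E3 → ℂ :=
  𝓕⁻ (fun ξ : E3 => (W.ψ (ρ * ⟪Γ.frame 0, ξ⟫_ℝ - k) : ℂ) * (𝓕 g : Lp ℂ 2 (volume : Measure E3)) ξ)

/-- The wave packet `g_T` of `g`: the frequency piece of its direction, localized to the tube by
the window `η`. Its Fourier transform lives in a `ρ⁻¹ × ρ⁻¹ × R⁻¹` cap if that of `g` lives in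
the `R⁻¹`-neighbourhood of the curve and `R^{1/2} ≤ ρ ≤ R`. -/
def wavePacket (W : WavePacketProfile) (Γ : PlanarCurve) (ρ : ℝ)
    (g : Lp ℂ 2 (volume : Measure E3)) (T : TubeIndex) (x : E3) : ℂ :=
  W.η (Γ.crossCoord ρ T.1 x - latticePoint T.2) * freqPiece W Γ ρ T.1 g x

/-- The (Plancherel) Fourier transform of `g` is supported in `N`. -/
def FourierSupportedIn (g : Lp ℂ 2 (volume : Measure E3)) (N : Set E3) : Prop :=
  ∀ᵐ ξ : E3, ξ ∉ N → (𝓕 g : Lp ℂ 2 (volume : Measure E3)) ξ = 0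

/-- `g = ∑_{T ∈ 𝕋} g_T` on `S`, up to rapidly decaying tails `D_N R^{-N} ‖g‖₂`. -/
def DecomposesOn (W : WavePacketProfile) (Γ : PlanarCurve) (ρ R : ℝ) (D : ℕ → ℝ) (S : Set E3)
    (𝕋 : Finset TubeIndex) (g : Lp ℂ 2 (volume : Measure E3)) : Prop :=
  ∀ N : ℕ, ∀ᵐ x ∂(volume.restrict S),
    ‖g x - ∑ T ∈ 𝕋, wavePacket W Γ ρ g T x‖ ≤ D N * R ^ (-(N : ℝ)) * ‖g‖

/-- `𝒬` is (the set of centres of) a finite collection of disjoint `ρ`-balls contained in `S`. -/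
def IsBallFamily (ρ : ℝ) (S : Set E3) (𝒬 : Finset E3) : Prop :=
  (𝒬 : Set E3).PairwiseDisjoint (fun q => ball q ρ) ∧ ∀ q ∈ 𝒬, ball q ρ ⊆ S

/-- The number of balls of the collection that meet the set `T`. -/
def incidence (ρ : ℝ) (𝒬 : Finset E3) (T : Set E3) : ℕ :=
  {q : E3 | q ∈ 𝒬 ∧ (ball q ρ ∩ T).Nonempty}.ncard

end PlanarBilinear

end

/-! Since the values of F agree up to a factor R^δ, the sum is at most |𝒬| R^δ F(q) for any single
ball q. Hölder on q, which needs p ≤ 4, reduces everything to one ball whose energy ∫_q |g₀g₁|² is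
at most about ρ⁻¹ R⁻² |𝒬|⁻² X ‖g₀‖²‖g₁‖². Taking X = |𝒬| gives one term of the minimum and X = η²
the other; `sum_le_of_ball_bound` does the exponents.

X = |𝒬|: two separated arcs of a curved graph have separated slopes, so a point ξ is a sum of points
of their r-neighbourhoods only in a set of volume O(r³) (`dist_le_of_sum_close`). Plancherel and
Cauchy–Schwarz with r = R⁻¹ bound ∫|g₀g₁|² by R⁻³‖g₀‖²‖g₁‖², and some ball carries at most the
average.

X = η²: on q only packets whose tubes meet q matter, up to O(R⁻⁶). The frequency cap of a packet has
thickness about R⁻¹ across the curve (`IsSpectrum.packetFreq_support`; here R ≤ ρ² enters), so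
localizing a packet to q keeps only a fraction ρ/R of its energy
(`IsSpectrum.lintegral_conv_cutFreq_le`). The bilinear estimate at scale r = 3/ρ then yields
ρ⁻³(ρ/R)² = ρ⁻¹R⁻² times the product of the packet energies at q (`lintegral_ball_packets_le`).
Counting incidences twice and using almost orthogonality, the energies met by the balls sum to
O(η‖g_j‖²) for each j, and Cauchy–Schwarz provides one ball where the product of the two energies is
O(η²|𝒬|⁻²‖g₀‖²‖g₁‖²) (`exists_mul_le_of_sum_le`). -/

namespace PlanarBilinear

open scoped ENNReal

/-! ### Plancherel on L¹ ∩ L², and superpositions of translates. -/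

section FourierAnalysis

variable {V W : Type*} [NormedAddCommGroup V] [InnerProductSpace ℝ V] [FiniteDimensional ℝ V]
  [MeasurableSpace V] [BorelSpace V]
  [NormedAddCommGroup W] [InnerProductSpace ℝ W] [FiniteDimensional ℝ W]
  [MeasurableSpace W] [BorelSpace W]

theorem continuous_fourierInv_of_integrable {h : V → ℂ} (hh : Integrable h) :
    Continuous (𝓕⁻ h) := by
  have h2 : Continuous (𝓕 h) := VectorFourier.fourierIntegral_continuous
    Real.continuous_fourierChar (by exact continuous_inner) hh
  have : 𝓕⁻ h = fun x => 𝓕 h (-x) := by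
    ext x; exact Real.fourierInv_eq_fourier_neg h x
  rw [this]
  exact h2.comp continuous_neg

theorem norm_fourierInv_le (h : V → ℂ) (x : V) : ‖𝓕⁻ h x‖ ≤ ∫ ξ, ‖h ξ‖ := by
  rw [Real.fourierInv_eq]
  refine (norm_integral_le_integral_norm _).trans (le_of_eq ?_)
  simp

/-- On `L¹ ∩ L²` the inverse Fourier transform of `L²` is given by the Fourier integral. -/
theorem fourierInv_toLp_ae_eq {h : V → ℂ} (h1 : Integrable h) (h2 : MemLp h 2) :
    ((𝓕⁻ (h2.toLp h : Lp ℂ 2 (volume : Measure V)) : Lp ℂ 2 (volume : Measure V)) : V → ℂ)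
      =ᵐ[volume] 𝓕⁻ h := by
  -- It suffices to test against smooth compactly supported w. The transform moves onto w on both
  -- sides: by duality of tempered distributions for the L² transform, by Fubini for the integral.
  refine ae_eq_of_integral_contDiff_smul_eq
    ((Lp.memLp _).locallyIntegrable (by norm_num))
    (continuous_fourierInv_of_integrable h1).locallyIntegrable fun w hw hw' => ?_
  have hw1 : ContDiff ℝ ∞ (fun x => (w x : ℂ)) := Complex.ofRealCLM.contDiff.comp hw
  have hw2 : HasCompactSupport (fun x => (w x : ℂ)) := hw'.comp_left (g := fun t : ℝ => (t : ℂ)) rfl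
  set φ : 𝓢(V, ℂ) := hw2.toSchwartzMap hw1
  have hφ : ∀ x, φ x = (w x : ℂ) := fun x => rfl
  have e1 := congrArg (fun u => u φ)
    (Lp.fourierInv_toTemperedDistribution_eq (h2.toLp h : Lp ℂ 2 (volume : Measure V)))
  simp only [TemperedDistribution.fourierInv_apply, Lp.toTemperedDistribution_apply] at e1
  have e2 : ∫ x, w x • ((𝓕⁻ (h2.toLp h : Lp ℂ 2 (volume : Measure V)) :
      Lp ℂ 2 (volume : Measure V)) : V → ℂ) x = ∫ x, (𝓕⁻ φ) x • h x := by
    trans ∫ x, (𝓕⁻ φ) x • (h2.toLp h : V → ℂ) x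
    · rw [e1]
      exact integral_congr_ae (Filter.Eventually.of_forall fun x => by simp [hφ])
    · refine integral_congr_ae ?_
      filter_upwards [h2.coeFn_toLp] with x hx
      rw [hx]
  rw [e2]
  have hL : Continuous fun p : V × V => (-innerₗ V : V →ₗ[ℝ] V →ₗ[ℝ] ℝ) p.1 p.2 := by
    simp only [LinearMap.neg_apply, innerₗ_apply_apply]
    fun_prop
  have := VectorFourier.integral_fourierIntegral_smul_eq_flip
    (L := (-innerₗ V : V →ₗ[ℝ] V →ₗ[ℝ] ℝ)) (μ := volume) (ν := volume)
    Real.continuous_fourierChar hL φ.integrable h1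
  rw [SchwartzMap.fourierInv_coe]
  refine this.trans (integral_congr_ae (Filter.Eventually.of_forall fun x => ?_))
  simp only [hφ]
  rw [show VectorFourier.fourierIntegral Real.fourierChar volume (-innerₗ V).flip h x = 𝓕⁻ h x from ?_]
  · simp
  · rw [Real.fourierInv_eq]
    simp [VectorFourier.fourierIntegral, real_inner_comm]

theorem lintegral_enorm_sq_eq_eLpNorm (f : V → ℂ) :
    ∫⁻ x, ‖f x‖ₑ ^ 2 = eLpNorm f 2 volume ^ 2 := by
  rw [eLpNorm_eq_lintegral_rpow_enorm_toReal (by norm_num) (by norm_num)]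
  simp only [ENNReal.toReal_ofNat, one_div, ENNReal.rpow_ofNat]
  rw [← ENNReal.rpow_natCast, ← ENNReal.rpow_mul]
  norm_num

/-- Plancherel's theorem for the inverse Fourier integral on `L¹ ∩ L²`. -/
theorem lintegral_enorm_sq_fourierInv {h : V → ℂ} (h1 : Integrable h) (h2 : MemLp h 2) :
    ∫⁻ x, ‖𝓕⁻ h x‖ₑ ^ 2 = ∫⁻ ξ, ‖h ξ‖ₑ ^ 2 := by
  rw [lintegral_enorm_sq_eq_eLpNorm, lintegral_enorm_sq_eq_eLpNorm,
    ← eLpNorm_congr_ae (fourierInv_toLp_ae_eq h1 h2), ← eLpNorm_congr_ae h2.coeFn_toLp,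
    ← Lp.enorm_def, ← Lp.enorm_def]
  have : ‖(𝓕⁻ (h2.toLp h : Lp ℂ 2 (volume : Measure V)) : Lp ℂ 2 (volume : Measure V))‖
      = ‖(h2.toLp h : Lp ℂ 2 (volume : Measure V))‖ := by
    rw [← Lp.norm_fourier_eq, FourierTransform.fourier_fourierInv_eq]
  rw [← ofReal_norm, ← ofReal_norm, this]

/-- An `L²` function with integrable Fourier transform is the inverse Fourier integral of it. -/
theorem lp_ae_eq_fourierInv (g : Lp ℂ 2 (volume : Measure V))
    (h1 : Integrable ((𝓕 g : Lp ℂ 2 (volume : Measure V)) : V → ℂ)) :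
    (g : V → ℂ) =ᵐ[volume] 𝓕⁻ ((𝓕 g : Lp ℂ 2 (volume : Measure V)) : V → ℂ) := by
  have := fourierInv_toLp_ae_eq h1 (Lp.memLp _)
  rwa [Lp.toLp_coeFn, FourierTransform.fourierInv_fourier_eq] at this

/-- The superposition of the translates of `h` by `L ζ` with the amplitudes `a ζ`. -/
noncomputable def shearConv (L : W →L[ℝ] V) (a : W → ℂ) (h : V → ℂ) (ξ : V) : ℂ :=
  ∫ ζ, a ζ * h (ξ - L ζ)

theorem measurePreserving_shear (L : W →L[ℝ] V) :
    MeasurePreserving (fun z : W × V => (z.1, z.2 - L z.1))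
      ((volume : Measure W).prod (volume : Measure V)) (volume.prod volume) := by
  refine (MeasurePreserving.id volume).skew_product
    (g := fun (ζ : W) (ξ : V) => ξ - L ζ) ?_ ?_
  · fun_prop
  · exact Filter.Eventually.of_forall fun ζ =>
      (measurePreserving_sub_right (volume : Measure V) (L ζ)).map_eq

theorem integrable_shear (L : W →L[ℝ] V) {a : W → ℂ} {h : V → ℂ}
    (ha : Integrable a) (hh : Integrable h) :
    Integrable (fun z : W × V => a z.1 * h (z.2 - L z.1)) (volume.prod volume) :=
  (measurePreserving_shear L).integrable_comp_of_integrable (ha.mul_prod hh)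

theorem integrable_shearConv (L : W →L[ℝ] V) {a : W → ℂ} {h : V → ℂ}
    (ha : Integrable a) (hh : Integrable h) : Integrable (shearConv L a h) :=
  (integrable_shear L ha hh).integral_prod_right

theorem measurable_shearConv (L : W →L[ℝ] V) {a : W → ℂ} {h : V → ℂ}
    (ha : Measurable a) (hh : Measurable h) : Measurable (shearConv L a h) := by
  have : StronglyMeasurable (fun z : V × W => a z.2 * h (z.1 - L z.2)) :=
    Measurable.stronglyMeasurable (by fun_prop)
  exact this.integral_prod_right.measurable

/-- The convolution theorem: translation by L ζ becomes modulation by ⟪L ζ, x⟫ = ⟪ζ, L* x⟫. With L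
the identity it treats products of functions on the same space; with L a map from the plane it
treats multiplication by a window depending only on the cross-sectional coordinates. -/
theorem fourierInv_shearConv (L : W →L[ℝ] V) {a : W → ℂ} {h : V → ℂ}
    (ha : Integrable a) (hh : Integrable h) (x : V) :
    𝓕⁻ (shearConv L a h) x = 𝓕⁻ a (L.adjoint x) * 𝓕⁻ h x := by
  simp only [Real.fourierInv_eq, shearConv]
  calc ∫ ξ, 𝐞 ⟪ξ, x⟫_ℝ • ∫ ζ, a ζ * h (ξ - L ζ)
      = ∫ ξ, ∫ ζ, 𝐞 ⟪ξ, x⟫_ℝ • (a ζ * h (ξ - L ζ)) := by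
        simp_rw [Circle.smul_def, integral_smul]
    _ = ∫ ζ, ∫ ξ, 𝐞 ⟪ξ, x⟫_ℝ • (a ζ * h (ξ - L ζ)) := by
        refine (integral_integral_swap ?_).symm
        refine (integrable_shear L ha hh).mono ?_ ?_
        · exact (Real.continuous_fourierChar.comp (by fun_prop)).aestronglyMeasurable.smul
            (integrable_shear L ha hh).aestronglyMeasurable
        · filter_upwards with z using by simp [Function.uncurry]
    _ = ∫ ζ, (𝐞 ⟪ζ, L.adjoint x⟫_ℝ • a ζ) * ∫ ξ, 𝐞 ⟪ξ, x⟫_ℝ • h ξ := by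
        congr 1; ext ζ
        rw [← integral_add_right_eq_self _ (L ζ), ← integral_const_mul]
        congr 1; ext ξ
        rw [ContinuousLinearMap.adjoint_inner_right, Circle.smul_def, Circle.smul_def,
          Circle.smul_def, inner_add_left, AddChar.map_add_eq_mul, Circle.coe_mul,
          add_sub_cancel_right]
        simp only [smul_eq_mul]
        ring
    _ = _ := by rw [integral_mul_const]

theorem sq_lintegral_le {α : Type*} [MeasurableSpace α] (μ : Measure α) {f : α → ℝ≥0∞}
    (hf : Measurable f) : (∫⁻ x, f x ∂μ) ^ 2 ≤ μ {x | f x ≠ 0} * ∫⁻ x, f x ^ 2 ∂μ := by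
  have hs : MeasurableSet {x | f x ≠ 0} := (hf (measurableSet_singleton 0)).compl
  have h1 : ∫⁻ x, f x ∂μ = ∫⁻ x, ({x | f x ≠ 0}.indicator (1 : α → ℝ≥0∞) * f) x ∂μ := by
    congr 1; ext x
    by_cases hx : f x = 0 <;> simp [hx]
  have h2 := ENNReal.lintegral_mul_le_Lp_mul_Lq μ Real.HolderConjugate.two_two
    (measurable_one.indicator hs).aemeasurable hf.aemeasurable
  rw [h1]
  refine (pow_le_pow_left' h2 2).trans (le_of_eq ?_)
  rw [mul_pow]
  simp only [one_div, ← ENNReal.rpow_natCast, ← ENNReal.rpow_mul]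
  norm_num
  congr 1
  rw [← lintegral_indicator_one hs]
  congr 1; ext x
  by_cases hx : f x = 0 <;> simp [hx]

/-- Cauchy–Schwarz in ζ costs only the measure of the ζ that contribute at ξ; Tonelli and
translation invariance do the rest. Every geometric gain below enters through the constant c. -/
theorem lintegral_enorm_sq_shearConv_le (L : W →L[ℝ] V) {a : W → ℂ} {h : V → ℂ}
    (ha : Measurable a) (hh : Measurable h) (c : ℝ≥0∞)
    (hc : ∀ ξ, volume {ζ | a ζ ≠ 0 ∧ h (ξ - L ζ) ≠ 0} ≤ c) :
    ∫⁻ ξ, ‖shearConv L a h ξ‖ₑ ^ 2 ≤ c * ((∫⁻ ζ, ‖a ζ‖ₑ ^ 2) * ∫⁻ ξ, ‖h ξ‖ₑ ^ 2) := by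
  calc ∫⁻ ξ, ‖shearConv L a h ξ‖ₑ ^ 2
      ≤ ∫⁻ ξ, c * ∫⁻ ζ, ‖a ζ‖ₑ ^ 2 * ‖h (ξ - L ζ)‖ₑ ^ 2 := by
        refine lintegral_mono fun ξ => ?_
        calc ‖shearConv L a h ξ‖ₑ ^ 2 ≤ (∫⁻ ζ, ‖a ζ * h (ξ - L ζ)‖ₑ) ^ 2 :=
              pow_le_pow_left' (enorm_integral_le_lintegral_enorm _) 2
          _ ≤ _ := sq_lintegral_le _ (by fun_prop)
          _ ≤ c * ∫⁻ ζ, ‖a ζ‖ₑ ^ 2 * ‖h (ξ - L ζ)‖ₑ ^ 2 := by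
              gcongr
              · refine le_trans (le_of_eq ?_) (hc ξ)
                congr 1; ext ζ; simp
              · exact le_of_eq (by rw [enorm_mul, mul_pow])
    _ = c * ∫⁻ ξ, ∫⁻ ζ, ‖a ζ‖ₑ ^ 2 * ‖h (ξ - L ζ)‖ₑ ^ 2 := by
        rw [lintegral_const_mul]
        exact Measurable.lintegral_prod_right (by fun_prop)
    _ = c * ∫⁻ ζ, ∫⁻ ξ, ‖a ζ‖ₑ ^ 2 * ‖h (ξ - L ζ)‖ₑ ^ 2 := by
        rw [lintegral_lintegral_swap]
        exact (by fun_prop : Measurable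
          (fun z : V × W => ‖a z.2‖ₑ ^ 2 * ‖h (z.1 - L z.2)‖ₑ ^ 2)).aemeasurable
    _ = c * ((∫⁻ ζ, ‖a ζ‖ₑ ^ 2) * ∫⁻ ξ, ‖h ξ‖ₑ ^ 2) := by
        congr 1
        rw [← lintegral_mul_const _ (by fun_prop)]
        congr 1; ext ζ
        rw [lintegral_const_mul _ (by fun_prop),
          lintegral_sub_right_eq_self (fun ξ => ‖h ξ‖ₑ ^ 2) (L ζ)]

set_option linter.unusedSectionVars false in
theorem exists_ne_zero_of_shearConv_ne_zero {L : W →L[ℝ] V} {a : W → ℂ} {h : V → ℂ} {ξ : V}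
    (hξ : shearConv L a h ξ ≠ 0) : ∃ ζ, a ζ ≠ 0 ∧ h (ξ - L ζ) ≠ 0 := by
  by_contra! H
  refine hξ ?_
  rw [shearConv]
  refine integral_eq_zero_of_ae (Filter.Eventually.of_forall fun ζ => ?_)
  by_cases h0 : a ζ = 0
  · simp [h0]
  · simp [H ζ h0]

end FourierAnalysis

/-! ### Volume bounds in three-space. -/

theorem volume_le_of_pairwise_dist_le {s : Set E3} {d : ℝ}
    (hs : ∀ x ∈ s, ∀ y ∈ s, dist x y ≤ d) : volume s ≤ ENNReal.ofReal (8 * d ^ 3) := by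
  rcases s.eq_empty_or_nonempty with rfl | ⟨y, hy⟩
  · simp
  have hd : 0 ≤ d := dist_nonneg.trans (hs y hy y hy)
  calc volume s ≤ volume (closedBall y d) := measure_mono fun x hx => hs x hx y hy
    _ = ENNReal.ofReal d ^ 3 * ENNReal.ofReal (Real.pi * 4 / 3) :=
        EuclideanSpace.volume_closedBall_fin_three _ _
    _ = ENNReal.ofReal (d ^ 3 * (Real.pi * 4 / 3)) := by
        rw [← ENNReal.ofReal_pow hd, ← ENNReal.ofReal_mul (by positivity)]
    _ ≤ ENNReal.ofReal (8 * d ^ 3) := by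
        refine ENNReal.ofReal_le_ofReal ?_
        have := Real.pi_le_four
        nlinarith [pow_nonneg hd 3]

theorem exists_orthonormalBasis_zero_eq {ν : E3} (hν : ‖ν‖ = 1) :
    ∃ b : OrthonormalBasis (Fin 3) ℝ E3, b 0 = ν := by
  obtain ⟨b, hb⟩ := Orthonormal.exists_orthonormalBasis_extension_of_card_eq (𝕜 := ℝ) (E := E3)
    (ι := Fin 3) (by simp) (v := fun _ => ν) (s := {0}) (by
      refine ⟨fun i => by simpa using hν, fun i j hij => ?_⟩
      exact absurd (Subsingleton.elim i j) hij)
  exact ⟨b, hb 0 rfl⟩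

/-- In an orthonormal basis starting with ν the set lies in a box with sides 2w, 2r, 2r. -/
theorem volume_ball_inter_slab_le {ν : E3} (hν : ‖ν‖ = 1) {r w c : ℝ} (hr : 0 ≤ r) :
    volume {ζ : E3 | ‖ζ‖ ≤ r ∧ |⟪ν, ζ⟫_ℝ - c| ≤ w} ≤ ENNReal.ofReal (8 * r ^ 2 * w) := by
  obtain ⟨b, rfl⟩ := exists_orthonormalBasis_zero_eq hν
  have h1 : MeasurePreserving (fun x : E3 => (WithLp.ofLp (b.repr x) : Fin 3 → ℝ))
      volume volume :=
    (PiLp.volume_preserving_ofLp (Fin 3)).comp b.measurePreserving_repr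
  set l : Fin 3 → ℝ := ![c - w, -r, -r]
  set u : Fin 3 → ℝ := ![c + w, r, r]
  have h2 : {ζ : E3 | ‖ζ‖ ≤ r ∧ |⟪b 0, ζ⟫_ℝ - c| ≤ w}
      ⊆ (fun x : E3 => (WithLp.ofLp (b.repr x) : Fin 3 → ℝ)) ⁻¹' Icc l u := by
    rintro ζ ⟨h3, h4⟩
    have h5 : ∀ i, |⟪b i, ζ⟫_ℝ| ≤ r := fun i => by
      refine (abs_real_inner_le_norm _ _).trans ?_
      simpa using h3
    have h5' := fun i => abs_le.1 (h5 i)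
    rw [abs_le] at h4
    constructor <;> intro i <;> simp only [b.repr_apply_apply, l, u] <;> fin_cases i <;> simp
    · linarith
    · linarith [h5' 1]
    · linarith [h5' 2]
    · linarith
    · linarith [h5' 1]
    · linarith [h5' 2]
  refine (measure_mono h2).trans ?_
  rw [h1.measure_preimage measurableSet_Icc.nullMeasurableSet, Real.volume_Icc_pi,
    Fin.prod_univ_three]
  simp only [l, u, Matrix.cons_val]
  by_cases hw : 0 ≤ w
  · rw [← ENNReal.ofReal_mul (by linarith), ← ENNReal.ofReal_mul (by nlinarith)]
    exact ENNReal.ofReal_le_ofReal (by nlinarith)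
  · rw [ENNReal.ofReal_of_nonpos (by linarith)]
    simp

/-! ### Geometry of the curve: transversality and flatness of caps. -/

namespace PlanarCurve

variable {Γ : PlanarCurve} {A : ℝ}

theorem inner_frame_zero_point (Γ : PlanarCurve) (s : ℝ) : ⟪Γ.frame 0, Γ.point s⟫_ℝ = s := by
  simp [point, inner_add_right, inner_smul_right]

theorem inner_frame_one_point (Γ : PlanarCurve) (s : ℝ) :
    ⟪Γ.frame 1, Γ.point s⟫_ℝ = Γ.φ s := by
  simp [point, inner_add_right, inner_smul_right]

theorem abs_inner_frame_le (Γ : PlanarCurve) (i : Fin 3) (x : E3) :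
    |⟪Γ.frame i, x⟫_ℝ| ≤ ‖x‖ := by
  simpa using abs_real_inner_le_norm (Γ.frame i) x

theorem norm_point_sub_le (Γ : PlanarCurve) (x y : ℝ) :
    ‖Γ.point x - Γ.point y‖ ≤ |x - y| + |Γ.φ x - Γ.φ y| := by
  have : Γ.point x - Γ.point y = (x - y) • Γ.frame 0 + (Γ.φ x - Γ.φ y) • Γ.frame 1 := by
    simp only [point]; module
  rw [this]
  refine (norm_add_le _ _).trans ?_
  simp [norm_smul]

theorem point_sub_sub (Γ : PlanarCurve) (x y x' y' : ℝ) :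
    x - x' + (y - y') = ⟪Γ.frame 0, Γ.point x + Γ.point y - (Γ.point x' + Γ.point y')⟫_ℝ := by
  simp only [inner_sub_right, inner_add_right, inner_frame_zero_point]; ring

namespace IsCurved

variable (hΓ : Γ.IsCurved A)
include hΓ

theorem differentiable : Differentiable ℝ Γ.φ := hΓ.contDiff.differentiable (by norm_num)

theorem differentiable_deriv : Differentiable ℝ (deriv Γ.φ) :=
  hΓ.contDiff.differentiable_deriv_two

theorem continuous_point : Continuous Γ.point := by
  have := hΓ.differentiable.continuous
  unfold point
  fun_prop

theorem abs_sub_le {x y : ℝ} (hx : x ∈ Icc Γ.a Γ.b) (hy : y ∈ Icc Γ.a Γ.b) :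
    |Γ.φ x - Γ.φ y| ≤ A * |x - y| :=
  Convex.norm_image_sub_le_of_norm_deriv_le (fun z _ => hΓ.differentiable z)
    hΓ.abs_deriv_le (convex_Icc _ _) hy hx

theorem norm_point_sub_le {x y : ℝ} (hA : 1 ≤ A) (hx : x ∈ Icc Γ.a Γ.b)
    (hy : y ∈ Icc Γ.a Γ.b) : ‖Γ.point x - Γ.point y‖ ≤ 2 * A * |x - y| := by
  have h1 := Γ.norm_point_sub_le x y
  have h2 := hΓ.abs_sub_le hx hy
  nlinarith [abs_nonneg (x - y)]

theorem abs_deriv_sub_le {x y : ℝ} (hx : x ∈ Icc Γ.a Γ.b) (hy : y ∈ Icc Γ.a Γ.b) (hA : 1 ≤ A) :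
    |deriv Γ.φ x - deriv Γ.φ y| ≤ A * |x - y| := by
  refine Convex.norm_image_sub_le_of_norm_deriv_le (fun z _ => hΓ.differentiable_deriv z)
    (fun z hz => ?_) (convex_Icc _ _) hy hx
  rw [Real.norm_eq_abs, abs_le]
  have := hΓ.le_deriv2 z hz
  have : 0 < A⁻¹ := by positivity
  exact ⟨by linarith, hΓ.deriv2_le z hz⟩

theorem le_deriv_sub {x y : ℝ} (hx : x ∈ Icc Γ.a Γ.b) (hy : y ∈ Icc Γ.a Γ.b) (hxy : x ≤ y) :
    A⁻¹ * (y - x) ≤ deriv Γ.φ y - deriv Γ.φ x :=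
  Convex.mul_sub_le_image_sub_of_le_deriv (convex_Icc _ _)
    hΓ.differentiable_deriv.continuous.continuousOn
    hΓ.differentiable_deriv.differentiableOn (fun z hz => hΓ.le_deriv2 z (interior_subset hz))
    x hx y hy hxy

theorem exists_slope {s t x y : ℝ} (hx : x ∈ Icc s t) (hy : y ∈ Icc s t) :
    ∃ c ∈ Icc s t, Γ.φ x - Γ.φ y = deriv Γ.φ c * (x - y) := by
  wlog hxy : y ≤ x generalizing x y
  · obtain ⟨c, hc, h⟩ := this hy hx (by linarith)
    exact ⟨c, hc, by linarith⟩
  rcases hxy.eq_or_lt with rfl | hlt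
  · exact ⟨y, hy, by simp⟩
  obtain ⟨c, hc, h⟩ := exists_deriv_eq_slope Γ.φ hlt hΓ.differentiable.continuous.continuousOn
    hΓ.differentiable.differentiableOn
  refine ⟨c, ⟨hy.1.trans hc.1.le, hc.2.le.trans hx.2⟩, ?_⟩
  rw [h]
  field_simp [sub_ne_zero.2 hlt.ne']

theorem abs_taylor_le {x y : ℝ} (hx : x ∈ Icc Γ.a Γ.b) (hy : y ∈ Icc Γ.a Γ.b) (hA : 1 ≤ A) :
    |Γ.φ x - Γ.φ y - deriv Γ.φ y * (x - y)| ≤ A * (x - y) ^ 2 := by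
  have hsub : uIcc x y ⊆ Icc Γ.a Γ.b := ordConnected_Icc.uIcc_subset hx hy
  obtain ⟨c, hc, h⟩ := hΓ.exists_slope (s := min x y) (t := max x y) left_mem_uIcc right_mem_uIcc
  rw [h, ← sub_mul, abs_mul, pow_two, ← abs_mul_abs_self (x - y), ← mul_assoc]
  gcongr
  refine (hΓ.abs_deriv_sub_le (hsub hc) hy hA).trans ?_
  gcongr 1
  rw [abs_sub_comm, abs_sub_comm x]
  exact abs_sub_right_of_mem_uIcc hc

theorem mem_cthickening_arc {s t r : ℝ} (hr : 0 ≤ r) {ξ : E3}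
    (hξ : ξ ∈ cthickening r (Γ.arc s t)) : ∃ x ∈ Icc s t, ‖ξ - Γ.point x‖ ≤ r := by
  have hc : IsCompact (Γ.arc s t) := isCompact_Icc.image hΓ.continuous_point
  rw [hc.cthickening_eq_biUnion_closedBall hr] at hξ
  simp only [mem_iUnion, arc, mem_image, exists_prop] at hξ
  obtain ⟨_, ⟨x, hx, rfl⟩, h⟩ := hξ
  exact ⟨x, hx, by simpa [dist_eq_norm] using h⟩

/-- Separated sub-curves have separated slopes. -/
theorem deriv_separated (hA : 1 ≤ A) {s t : Fin 2 → ℝ}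
    (hst : ∀ j, Γ.a ≤ s j ∧ s j ≤ t j ∧ t j ≤ Γ.b)
    (hsep : ∀ ξ ∈ Γ.arc (s 0) (t 0), ∀ ζ ∈ Γ.arc (s 1) (t 1), A⁻¹ ≤ dist ξ ζ)
    {x y : ℝ} (hx : x ∈ Icc (s 0) (t 0)) (hy : y ∈ Icc (s 1) (t 1)) :
    1 / (2 * A ^ 3) ≤ |deriv Γ.φ x - deriv Γ.φ y| := by
  have hA0 : 0 < A := by linarith
  have hx' : x ∈ Icc Γ.a Γ.b := ⟨(hst 0).1.trans hx.1, hx.2.trans (hst 0).2.2⟩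
  have hy' : y ∈ Icc Γ.a Γ.b := ⟨(hst 1).1.trans hy.1, hy.2.trans (hst 1).2.2⟩
  have h1 := hsep _ (mem_image_of_mem _ hx) _ (mem_image_of_mem _ hy)
  rw [dist_eq_norm] at h1
  have h2 := h1.trans (hΓ.norm_point_sub_le hA hx' hy')
  -- Points at distance at least A⁻¹ have parameters at distance at least 1/(2A²), as the
  -- parametrization is 2A-Lipschitz. The bound φ'' ≥ A⁻¹ then costs one more factor A.
  have h3 : 1 / (2 * A ^ 2) ≤ |x - y| := by
    rw [div_le_iff₀ (by positivity)]
    have := mul_le_mul_of_nonneg_left h2 hA0.le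
    rw [mul_inv_cancel₀ hA0.ne'] at this
    linarith
  have h4 : A⁻¹ * |x - y| ≤ |deriv Γ.φ x - deriv Γ.φ y| := by
    rcases le_total x y with h | h
    · have := hΓ.le_deriv_sub hx' hy' h
      rw [abs_sub_comm x y, abs_sub_comm (deriv _ _), abs_of_nonneg (sub_nonneg.2 h)]
      exact this.trans (le_abs_self _)
    · have := hΓ.le_deriv_sub hy' hx' h
      rw [abs_of_nonneg (sub_nonneg.2 h)]
      exact this.trans (le_abs_self _)
  refine le_trans (le_of_eq ?_) ((mul_le_mul_of_nonneg_left h3 (inv_nonneg.2 hA0.le)).trans h4)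
  field_simp

/-- The sum map of two separated sub-curves is quantitatively injective. -/
theorem dist_le_of_sum_close (hA : 1 ≤ A) {s t : Fin 2 → ℝ}
    (hst : ∀ j, Γ.a ≤ s j ∧ s j ≤ t j ∧ t j ≤ Γ.b)
    (hsep : ∀ ξ ∈ Γ.arc (s 0) (t 0), ∀ ζ ∈ Γ.arc (s 1) (t 1), A⁻¹ ≤ dist ξ ζ)
    {r : ℝ} {ξ ζ ζ' : E3}
    (h0 : ∃ x ∈ Icc (s 0) (t 0), ‖ζ - Γ.point x‖ ≤ r)
    (h1 : ∃ x ∈ Icc (s 1) (t 1), ‖ξ - ζ - Γ.point x‖ ≤ r)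
    (h0' : ∃ x ∈ Icc (s 0) (t 0), ‖ζ' - Γ.point x‖ ≤ r)
    (h1' : ∃ x ∈ Icc (s 1) (t 1), ‖ξ - ζ' - Γ.point x‖ ≤ r) :
    dist ζ ζ' ≤ 34 * A ^ 5 * r := by
  obtain ⟨x, hx, ex⟩ := h0
  obtain ⟨y, hy, ey⟩ := h1
  obtain ⟨x', hx', ex'⟩ := h0'
  obtain ⟨y', hy', ey'⟩ := h1'
  have hr : 0 ≤ r := (norm_nonneg _).trans ex
  have hsub : ∀ j, Icc (s j) (t j) ⊆ Icc Γ.a Γ.b := fun j =>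
    Icc_subset_Icc (hst j).1 (hst j).2.2
  set v : E3 := Γ.point x + Γ.point y - (Γ.point x' + Γ.point y')
  -- Both ζ + (ξ - ζ) and ζ' + (ξ - ζ') equal ξ, so the four curve points balance up to the four
  -- errors r.
  have hv : ‖v‖ ≤ 4 * r := by
    have : v = (ζ' - Γ.point x') + (ξ - ζ' - Γ.point y')
        - ((ζ - Γ.point x) + (ξ - ζ - Γ.point y)) := by simp only [v]; abel
    rw [this]
    refine (norm_sub_le _ _).trans ?_
    linarith [norm_add_le (ζ' - Γ.point x') (ξ - ζ' - Γ.point y'),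
      norm_add_le (ζ - Γ.point x) (ξ - ζ - Γ.point y)]
  have e0 : |x - x' + (y - y')| ≤ 4 * r := by
    rw [Γ.point_sub_sub]
    exact (Γ.abs_inner_frame_le 0 _).trans hv
  have e1 : |Γ.φ x - Γ.φ x' + (Γ.φ y - Γ.φ y')| ≤ 4 * r := by
    refine le_trans (le_of_eq ?_) ((Γ.abs_inner_frame_le 1 v).trans hv)
    simp only [v, inner_sub_right, inner_add_right, inner_frame_one_point]
    congr 1; ring
  -- The intermediate points c and d stay in the two separated parameter intervals, so their slopes
  -- differ by at least 1/(2A³). Eliminating y - y' from the two coordinate equations leaves this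
  -- difference times x - x'.
  obtain ⟨c, hc, ec⟩ := hΓ.exists_slope hx hx'
  obtain ⟨d, hd, ed⟩ := hΓ.exists_slope hy hy'
  have h2 := hΓ.deriv_separated hA hst hsep hc hd
  have h3 := hΓ.abs_deriv_le d (hsub 1 hd)
  have h4 : (deriv Γ.φ c - deriv Γ.φ d) * (x - x')
      = (Γ.φ x - Γ.φ x' + (Γ.φ y - Γ.φ y')) - deriv Γ.φ d * (x - x' + (y - y')) := by
    rw [ec, ed]; ring
  have h5 : |deriv Γ.φ c - deriv Γ.φ d| * |x - x'| ≤ 4 * r + A * (4 * r) := by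
    rw [← abs_mul, h4]
    refine (abs_sub _ _).trans ?_
    rw [abs_mul]
    gcongr
  have h6 : |x - x'| ≤ 16 * A ^ 4 * r := by
    have h7 : 1 / (2 * A ^ 3) * |x - x'| ≤ 4 * r + A * (4 * r) :=
      (mul_le_mul_of_nonneg_right h2 (abs_nonneg _)).trans h5
    rw [one_div, inv_mul_le_iff₀ (by positivity)] at h7
    refine h7.trans ?_
    have : 0 ≤ A ^ 3 * r * (A - 1) := by
      have : 0 ≤ A - 1 := by linarith
      positivity
    nlinarith
  have h8 := hΓ.norm_point_sub_le hA (hsub 0 hx) (hsub 0 hx')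
  rw [dist_eq_norm]
  have h9 : ζ - ζ' = (ζ - Γ.point x) - (ζ' - Γ.point x') + (Γ.point x - Γ.point x') := by abel
  have h10 : ‖ζ - ζ'‖ ≤ r + r + ‖Γ.point x - Γ.point x'‖ := by
    rw [h9]
    refine (norm_add_le _ _).trans ?_
    linarith [norm_sub_le (ζ - Γ.point x) (ζ' - Γ.point x')]
  have h11 : 2 * A * |x - x'| ≤ 2 * A * (16 * A ^ 4 * r) := by gcongr
  have h12 : r ≤ A ^ 5 * r := le_mul_of_one_le_left hr (one_le_pow₀ hA)
  nlinarith

end IsCurved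

/-- The unit normal to the curve inside its plane, at the parameter `s`. -/
noncomputable def curveNormal (Γ : PlanarCurve) (s : ℝ) : E3 :=
  (Real.sqrt (1 + deriv Γ.φ s ^ 2))⁻¹ • (Γ.frame 1 - deriv Γ.φ s • Γ.frame 0)

theorem sq_norm_frame (Γ : PlanarCurve) (d : ℝ) :
    ‖Γ.frame 1 - d • Γ.frame 0‖ ^ 2 = 1 + d ^ 2 ∧ ‖Γ.frame 0 + d • Γ.frame 1‖ ^ 2 = 1 + d ^ 2 := by
  simp only [← real_inner_self_eq_norm_sq, inner_sub_left, inner_sub_right, inner_add_left,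
    inner_add_right, real_inner_smul_left, real_inner_smul_right, OrthonormalBasis.inner_eq_ite]
  constructor <;> simp <;> ring

theorem norm_curveNormal (Γ : PlanarCurve) (s : ℝ) : ‖Γ.curveNormal s‖ = 1 := by
  have h := (Γ.sq_norm_frame (deriv Γ.φ s)).1
  have hp : 0 < Real.sqrt (1 + deriv Γ.φ s ^ 2) := Real.sqrt_pos.2 (by positivity)
  rw [curveNormal, norm_smul, ← Real.sqrt_sq (norm_nonneg (Γ.frame 1 - _)), h, norm_inv,
    Real.norm_of_nonneg hp.le, inv_mul_cancel₀ hp.ne']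

theorem norm_tangent (Γ : PlanarCurve) (s : ℝ) : ‖Γ.tangent s‖ = 1 := by
  have h := (Γ.sq_norm_frame (deriv Γ.φ s)).2
  have hp : 0 < Real.sqrt (1 + deriv Γ.φ s ^ 2) := Real.sqrt_pos.2 (by positivity)
  rw [tangent, norm_smul, ← Real.sqrt_sq (norm_nonneg (Γ.frame 0 + _)), h, norm_inv,
    Real.norm_of_nonneg hp.le, inv_mul_cancel₀ hp.ne']

theorem inner_curveNormal_tangent (Γ : PlanarCurve) (s : ℝ) :
    ⟪Γ.curveNormal s, Γ.tangent s⟫_ℝ = 0 := by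
  simp [curveNormal, tangent, inner_sub_left, inner_add_right, real_inner_smul_left,
    real_inner_smul_right]
  ring

theorem inner_curveNormal_planeNormal (Γ : PlanarCurve) (s : ℝ) :
    ⟪Γ.curveNormal s, Γ.planeNormal⟫_ℝ = 0 := by
  simp [curveNormal, planeNormal, inner_sub_left, real_inner_smul_left]

theorem inner_tangent_planeNormal (Γ : PlanarCurve) (s : ℝ) :
    ⟪Γ.tangent s, Γ.planeNormal⟫_ℝ = 0 := by
  simp [tangent, planeNormal, inner_add_left, real_inner_smul_left]

/-- The node is the projection of k/ρ to [a, b], which does not increase the distance to points of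
[a, b]. -/
theorem abs_sub_node_le (Γ : PlanarCurve) {x ρ : ℝ} (hx : x ∈ Icc Γ.a Γ.b) (k : ℤ) :
    |x - Γ.node ρ k| ≤ |x - k / ρ| := by
  rw [abs_le]
  have h1 := neg_abs_le (x - k / ρ)
  have h2 := le_abs_self (x - k / ρ)
  have h3 := abs_nonneg (x - k / ρ)
  obtain ⟨hx1, hx2⟩ := hx
  unfold node
  rcases max_cases Γ.a (min Γ.b (k / ρ)) with ⟨e, h⟩ | ⟨e, h⟩ <;>
  rcases min_cases Γ.b (k / ρ) with ⟨e', h'⟩ | ⟨e', h'⟩ <;> rw [e] <;> try rw [e'] at h ⊢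
  all_goals constructor <;> linarith

namespace IsCurved

variable (hΓ : Γ.IsCurved A)
include hΓ

theorem node_mem (ρ : ℝ) (k : ℤ) : Γ.node ρ k ∈ Icc Γ.a Γ.b :=
  ⟨le_max_left _ _, max_le hΓ.le (min_le_left _ _)⟩

/-- Pairing with the normal removes the first-order Taylor term, so only the quadratic remainder
survives. This is why an arc of length about ρ⁻¹ is flat to within O(ρ⁻²). -/
theorem abs_inner_curveNormal_le (hA : 1 ≤ A) {x y : ℝ} (hx : x ∈ Icc Γ.a Γ.b)
    (hy : y ∈ Icc Γ.a Γ.b) :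
    |⟪Γ.curveNormal y, Γ.point x⟫_ℝ - ⟪Γ.curveNormal y, Γ.point y⟫_ℝ| ≤ A * (x - y) ^ 2 := by
  rw [← inner_sub_right, curveNormal, real_inner_smul_left, inner_sub_left, real_inner_smul_left,
    inner_sub_right, inner_sub_right, inner_frame_zero_point, inner_frame_zero_point,
    inner_frame_one_point, inner_frame_one_point, abs_mul]
  have h1 : |(Real.sqrt (1 + deriv Γ.φ y ^ 2))⁻¹| ≤ 1 := by
    rw [abs_of_nonneg (by positivity)]
    refine inv_le_one_of_one_le₀ (Real.one_le_sqrt.2 ?_)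
    nlinarith [sq_nonneg (deriv Γ.φ y)]
  calc _ ≤ 1 * |Γ.φ x - Γ.φ y - deriv Γ.φ y * (x - y)| := by gcongr
    _ ≤ _ := by rw [one_mul]; exact hΓ.abs_taylor_le hx hy hA

end IsCurved

end PlanarCurve

/-! ### Lattice sums of Schwartz functions, uniformly in the base point. -/

section LatticeSums

/-- A summable weight on `ℤ²`. -/
noncomputable def latticeWeight (j : ℤ × ℤ) : ℝ :=
  ((1 + |(j.1 : ℝ)|) ^ 2)⁻¹ * ((1 + |(j.2 : ℝ)|) ^ 2)⁻¹

theorem summable_latticeWeight : Summable latticeWeight := by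
  have h : Summable fun j : ℤ => ((1 + |(j : ℝ)|) ^ 2)⁻¹ := by
    have h2 : Summable fun n : ℕ => (((1 : ℝ) + n) ^ 2)⁻¹ := by
      have := (summable_nat_add_iff 1).2 (Real.summable_nat_pow_inv.2 (by norm_num : 1 < 2))
      refine this.congr fun n => ?_
      push_cast; ring
    refine Summable.of_nat_of_neg ?_ ?_ <;> simpa using h2
  exact h.mul_of_nonneg h (fun _ => by positivity) (fun _ => by positivity)

theorem latticeWeight_nonneg (j : ℤ × ℤ) : 0 ≤ latticeWeight j := by
  unfold latticeWeight; positivity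

theorem sum_latticeWeight_sub_le (n : ℤ × ℤ) (s : Finset (ℤ × ℤ)) :
    ∑ m ∈ s, latticeWeight (n - m) ≤ ∑' j, latticeWeight j := by
  have : Summable fun m => latticeWeight (n - m) :=
    (Equiv.subLeft n).summable_iff.2 summable_latticeWeight
  refine (this.sum_le_tsum s fun m _ => latticeWeight_nonneg _).trans (le_of_eq ?_)
  exact (Equiv.subLeft n).tsum_eq latticeWeight

/-- Rounding moves each coordinate by at most 1/2, so each factor 1 + |·| of the weight is at most
2(1 + t); four factors give 16. -/
theorem inv_pow_le_latticeWeight (y : E2) (m : ℤ × ℤ) :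
    ((1 + ‖y - latticePoint m‖) ^ 4)⁻¹
      ≤ 16 * latticeWeight ((round (y 0), round (y 1)) - m) := by
  set t := ‖y - latticePoint m‖
  have h0 : ∀ i, ‖(y - latticePoint m) i‖ ≤ t := fun i => PiLp.norm_apply_le _ i
  have h1 : |y 0 - m.1| ≤ t := by simpa [latticePoint] using h0 0
  have h2 : |y 1 - m.2| ≤ t := by simpa [latticePoint] using h0 1
  have key : ∀ (z : ℝ) (l : ℤ), |z - l| ≤ t → 1 + |((round z - l : ℤ) : ℝ)| ≤ 2 * (1 + t) := by
    intro z l hz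
    have h3 := abs_sub_round z
    have h4 : ((round z - l : ℤ) : ℝ) = (z - l) - (z - round z) := by push_cast; ring
    rw [h4]
    have := abs_sub (z - l) (z - round z)
    have : 0 ≤ t := norm_nonneg _
    linarith
  have k1 := key _ _ h1
  have k2 := key _ _ h2
  simp only [latticeWeight, Prod.fst_sub, Prod.snd_sub]
  rw [← mul_inv, ← div_eq_mul_inv, inv_eq_one_div, div_le_div_iff₀ (by positivity) (by positivity),
    one_mul]
  calc _ ≤ (2 * (1 + t)) ^ 2 * (2 * (1 + t)) ^ 2 := by gcongr
    _ = _ := by ring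

/-- Decay of order N + 4 pays for the power N and leaves a summable lattice weight; moving y
essentially reindexes that weight, hence the uniformity. The case N = 0 serves almost orthogonality,
large N the tails off the tubes. -/
theorem exists_sum_pow_mul_norm_le (f : 𝓢(E2, ℂ)) (N : ℕ) :
    ∃ C : ℝ, 0 ≤ C ∧ ∀ (y : E2) (s : Finset (ℤ × ℤ)),
      ∑ m ∈ s, ‖y - latticePoint m‖ ^ N * ‖f (y - latticePoint m)‖ ≤ C := by
  set C0 : ℝ := 2 ^ (N + 4) *
    ((Finset.Iic (N + 4, 0)).sup fun m => SchwartzMap.seminorm ℝ m.1 m.2) f with hC0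
  have hC0' : 0 ≤ C0 := by positivity
  have hw : 0 ≤ ∑' j, latticeWeight j := tsum_nonneg latticeWeight_nonneg
  refine ⟨C0 * (16 * ∑' j, latticeWeight j), by positivity, fun y s => ?_⟩
  have h1 : ∀ z : E2, ‖z‖ ^ N * ‖f z‖ ≤ C0 * ((1 + ‖z‖) ^ 4)⁻¹ := fun z => by
    have := SchwartzMap.one_add_le_sup_seminorm_apply (𝕜 := ℝ) (m := (N + 4, 0)) (k := N + 4)
      (n := 0) le_rfl le_rfl f z
    rw [norm_iteratedFDeriv_zero] at this
    rw [← div_eq_mul_inv, le_div_iff₀ (by positivity)]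
    refine le_trans ?_ this
    rw [pow_add, mul_right_comm]
    gcongr
    linarith
  calc _ ≤ ∑ m ∈ s, C0 * (16 * latticeWeight ((round (y 0), round (y 1)) - m)) := by
        refine Finset.sum_le_sum fun m _ => (h1 _).trans ?_
        gcongr
        exact inv_pow_le_latticeWeight y m
    _ ≤ _ := by
        rw [← Finset.mul_sum, ← Finset.mul_sum]
        gcongr
        exact sum_latticeWeight_sub_le _ _

end LatticeSums

/-! ### Wave packets on the frequency side, and almost orthogonality. -/

section Packets

variable (W : WavePacketProfile) (Γ : PlanarCurve) (ρ : ℝ)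

/-- The adjoint of the map to the cross-sectional coordinates of the `k`-th family of tubes. -/
noncomputable def crossMap (k : ℤ) : E2 →L[ℝ] E3 :=
  ρ⁻¹ • ((EuclideanSpace.proj (0 : Fin 2) : E2 →L[ℝ] ℝ).smulRight (Γ.tangent (Γ.node ρ k))
    + (EuclideanSpace.proj (1 : Fin 2) : E2 →L[ℝ] ℝ).smulRight Γ.planeNormal)

theorem crossMap_apply (k : ℤ) (ζ : E2) :
    crossMap Γ ρ k ζ = ρ⁻¹ • (ζ 0 • Γ.tangent (Γ.node ρ k) + ζ 1 • Γ.planeNormal) := by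
  simp [crossMap]

theorem inner_plane_eq (x y : E2) : ⟪x, y⟫_ℝ = x 0 * y 0 + x 1 * y 1 := by
  simp [PiLp.inner_apply, Fin.sum_univ_two, mul_comm]

/-- Hence multiplying by a window in `crossCoord` is, in frequency, a superposition of translates
along the tangent and the plane normal only. -/
theorem adjoint_crossMap (k : ℤ) (x : E3) :
    (crossMap Γ ρ k).adjoint x = Γ.crossCoord ρ k x := by
  refine ext_inner_left ℝ fun ζ => ?_
  rw [ContinuousLinearMap.adjoint_inner_right, crossMap_apply, inner_plane_eq,
    real_inner_smul_left, inner_add_left, real_inner_smul_left, real_inner_smul_left]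
  simp only [PlanarCurve.crossCoord, PiLp.toLp_apply, Matrix.cons_val_zero, Matrix.cons_val_one]
  ring

theorem norm_crossMap_le {ρ : ℝ} (hρ : 0 < ρ) (k : ℤ) (ζ : E2) :
    ‖crossMap Γ ρ k ζ‖ ≤ ρ⁻¹ * ‖ζ‖ := by
  rw [crossMap_apply, norm_smul, norm_inv, Real.norm_of_nonneg hρ.le]
  gcongr
  have e : ‖ζ‖ ^ 2 = ζ 0 ^ 2 + ζ 1 ^ 2 := by
    rw [EuclideanSpace.norm_sq_eq, Fin.sum_univ_two]; simp
  refine (sq_le_sq₀ (norm_nonneg _) (norm_nonneg _)).1 ?_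
  rw [e, norm_add_sq_real, norm_smul, norm_smul,
    Γ.norm_tangent, real_inner_smul_left, real_inner_smul_right, Γ.inner_tangent_planeNormal]
  simp [PlanarCurve.planeNormal]

theorem norm_crossCoord_sub_le {ρ : ℝ} (hρ : 0 < ρ) (k : ℤ) (x y : E3) :
    ‖Γ.crossCoord ρ k x - Γ.crossCoord ρ k y‖ ≤ ρ⁻¹ * ‖x - y‖ := by
  rw [← adjoint_crossMap, ← adjoint_crossMap, ← map_sub]
  refine (ContinuousLinearMap.le_opNorm _ _).trans ?_
  gcongr
  rw [LinearIsometryEquiv.norm_map]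
  exact ContinuousLinearMap.opNorm_le_bound _ (by positivity) (norm_crossMap_le Γ hρ k)

theorem continuous_crossCoord (k : ℤ) : Continuous (Γ.crossCoord ρ k) := by
  have : Γ.crossCoord ρ k = (crossMap Γ ρ k).adjoint := by
    ext1 x; exact (adjoint_crossMap Γ ρ k x).symm
  rw [this]; fun_prop

/-- The Fourier transform of the window `η(· - m)`. -/
noncomputable def windowFreq (m : ℤ × ℤ) (ζ : E2) : ℂ := 𝐞 (-⟪ζ, latticePoint m⟫_ℝ) • 𝓕 W.η ζ

theorem continuous_windowFreq (m : ℤ × ℤ) : Continuous (windowFreq W m) := by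
  unfold windowFreq
  simp only [Circle.smul_def]
  have := (𝓕 W.η).continuous
  fun_prop

theorem norm_windowFreq (m : ℤ × ℤ) (ζ : E2) : ‖windowFreq W m ζ‖ = ‖𝓕 W.η ζ‖ := by
  simp [windowFreq]

theorem integrable_windowFreq (m : ℤ × ℤ) : Integrable (windowFreq W m) :=
  (𝓕 W.η).integrable.mono (continuous_windowFreq W m).aestronglyMeasurable
    (Filter.Eventually.of_forall fun ζ => (norm_windowFreq W m ζ).le)

theorem norm_le_one_of_windowFreq_ne_zero {m : ℤ × ℤ} {ζ : E2} (h : windowFreq W m ζ ≠ 0) :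
    ‖ζ‖ ≤ 1 := by
  by_contra! H
  exact h (by simp [windowFreq, W.η_fourier ζ H])

theorem fourierInv_windowFreq (m : ℤ × ℤ) (y : E2) :
    𝓕⁻ (windowFreq W m) y = W.η (y - latticePoint m) := by
  have h : (𝓕⁻ (𝓕 W.η)) (y - latticePoint m) = W.η (y - latticePoint m) := by
    rw [FourierTransform.fourierInv_fourier_eq]
  rw [← h, SchwartzMap.fourierInv_coe, Real.fourierInv_eq, Real.fourierInv_eq]
  congr 1; ext ζ
  rw [windowFreq, smul_smul, ← AddChar.map_add_eq_mul, inner_sub_right, ← sub_eq_add_neg]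

/-- The part of the frequency distribution `h` in the `k`-th strip. -/
noncomputable def pieceFreq (k : ℤ) (h : E3 → ℂ) (ξ : E3) : ℂ :=
  (W.ψ (ρ * ⟪Γ.frame 0, ξ⟫_ℝ - k) : ℂ) * h ξ

/-- The frequency distribution of a wave packet. -/
noncomputable def packetFreq (h : E3 → ℂ) (T : TubeIndex) : E3 → ℂ :=
  shearConv (crossMap Γ ρ T.1) (windowFreq W T.2) (pieceFreq W Γ ρ T.1 h)

variable {h : E3 → ℂ}

theorem measurable_pieceFreq (hm : Measurable h) (k : ℤ) :
    Measurable (pieceFreq W Γ ρ k h) := by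
  have := W.ψ_smooth.continuous
  unfold pieceFreq
  refine Measurable.mul (Continuous.measurable (by fun_prop)) hm

theorem norm_pieceFreq_le (k : ℤ) (ξ : E3) : ‖pieceFreq W Γ ρ k h ξ‖ ≤ ‖h ξ‖ := by
  rw [pieceFreq, norm_mul, Complex.norm_real]
  obtain ⟨h0, h1⟩ := W.ψ_mem (ρ * ⟪Γ.frame 0, ξ⟫_ℝ - k)
  refine mul_le_of_le_one_left (norm_nonneg _) ?_
  rwa [Real.norm_of_nonneg h0]

theorem integrable_pieceFreq (hm : Measurable h) (hi : Integrable h) (k : ℤ) :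
    Integrable (pieceFreq W Γ ρ k h) :=
  hi.mono (measurable_pieceFreq W Γ ρ hm k).aestronglyMeasurable
    (Filter.Eventually.of_forall (norm_pieceFreq_le W Γ ρ k))

theorem memLp_pieceFreq (hm : Measurable h) (hi : MemLp h 2) (k : ℤ) :
    MemLp (pieceFreq W Γ ρ k h) 2 :=
  hi.mono (measurable_pieceFreq W Γ ρ hm k).aestronglyMeasurable
    (Filter.Eventually.of_forall (norm_pieceFreq_le W Γ ρ k))

theorem memLp_two_of_lintegral_lt_top {V : Type*} [NormedAddCommGroup V] [InnerProductSpace ℝ V]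
    [FiniteDimensional ℝ V] [MeasurableSpace V] [BorelSpace V] {f : V → ℂ} (hf : Measurable f)
    (h : ∫⁻ x, ‖f x‖ₑ ^ 2 < ⊤) : MemLp f 2 := by
  refine ⟨hf.aestronglyMeasurable, ?_⟩
  rw [lintegral_enorm_sq_eq_eLpNorm] at h
  by_contra! H
  rw [top_le_iff.1 H] at h
  simp at h

theorem lintegral_enorm_sq_lt_top {V : Type*} [NormedAddCommGroup V] [InnerProductSpace ℝ V]
    [FiniteDimensional ℝ V] [MeasurableSpace V] [BorelSpace V] {f : V → ℂ} (hf : MemLp f 2) :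
    ∫⁻ x, ‖f x‖ₑ ^ 2 < ⊤ := by
  rw [lintegral_enorm_sq_eq_eLpNorm]
  exact ENNReal.pow_lt_top hf.2

theorem measurable_packetFreq (hm : Measurable h) (T : TubeIndex) :
    Measurable (packetFreq W Γ ρ h T) :=
  measurable_shearConv _ (continuous_windowFreq W _).measurable (measurable_pieceFreq W Γ ρ hm _)

theorem integrable_packetFreq (hm : Measurable h) (hi : Integrable h) (T : TubeIndex) :
    Integrable (packetFreq W Γ ρ h T) :=
  integrable_shearConv _ (integrable_windowFreq W _) (integrable_pieceFreq W Γ ρ hm hi _)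

theorem memLp_packetFreq (hm : Measurable h) (h2 : MemLp h 2) (T : TubeIndex) :
    MemLp (packetFreq W Γ ρ h T) 2 := by
  refine memLp_two_of_lintegral_lt_top (measurable_packetFreq W Γ ρ hm T) ?_
  refine (lintegral_enorm_sq_shearConv_le _ (continuous_windowFreq W _).measurable
    (measurable_pieceFreq W Γ ρ hm _) (volume (closedBall (0 : E2) 1)) fun ξ => ?_).trans_lt ?_
  · exact measure_mono fun ζ hζ => by simpa using norm_le_one_of_windowFreq_ne_zero W hζ.1
  · refine ENNReal.mul_lt_top measure_closedBall_lt_top (ENNReal.mul_lt_top ?_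
      (lintegral_enorm_sq_lt_top (memLp_pieceFreq W Γ ρ hm h2 _)))
    refine lintegral_enorm_sq_lt_top ?_
    exact ((𝓕 W.η).memLp 2 volume).mono (continuous_windowFreq W _).aestronglyMeasurable
      (Filter.Eventually.of_forall fun ζ => (norm_windowFreq W _ ζ).le)

theorem fourierInv_packetFreq (hm : Measurable h) (hi : Integrable h) (T : TubeIndex) (x : E3) :
    𝓕⁻ (packetFreq W Γ ρ h T) x =
      W.η (Γ.crossCoord ρ T.1 x - latticePoint T.2) * 𝓕⁻ (pieceFreq W Γ ρ T.1 h) x := by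
  rw [packetFreq, fourierInv_shearConv _ (integrable_windowFreq W _)
    (integrable_pieceFreq W Γ ρ hm hi _), adjoint_crossMap, fourierInv_windowFreq]

theorem wavePacket_eq_fourierInv {g : Lp ℂ 2 (volume : Measure E3)} (hm : Measurable h)
    (hi : Integrable h) (hg : h =ᵐ[volume] (𝓕 g : Lp ℂ 2 (volume : Measure E3)))
    (T : TubeIndex) : wavePacket W Γ ρ g T = 𝓕⁻ (packetFreq W Γ ρ h T) := by
  ext x
  rw [fourierInv_packetFreq W Γ ρ hm hi, wavePacket, freqPiece]
  congr 1
  refine Real.fourierInv_congr_ae ?_ x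
  filter_upwards [hg] with ξ hξ
  rw [pieceFreq, hξ]

theorem lintegral_enorm_sq_packetFreq (hm : Measurable h) (hi : Integrable h) (h2 : MemLp h 2)
    (T : TubeIndex) :
    ∫⁻ ξ, ‖packetFreq W Γ ρ h T ξ‖ₑ ^ 2 =
      ∫⁻ x, ‖W.η (Γ.crossCoord ρ T.1 x - latticePoint T.2)‖ₑ ^ 2 *
        ‖𝓕⁻ (pieceFreq W Γ ρ T.1 h) x‖ₑ ^ 2 := by
  rw [← lintegral_enorm_sq_fourierInv (integrable_packetFreq W Γ ρ hm hi T)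
    (memLp_packetFreq W Γ ρ hm h2 T)]
  simp_rw [fourierInv_packetFreq W Γ ρ hm hi, enorm_mul, mul_pow]

theorem sum_sq_profile_le (s : Finset ℤ) (t : ℝ) : ∑ k ∈ s, W.ψ (t - k) ^ 2 ≤ 1 := by
  calc ∑ k ∈ s, W.ψ (t - k) ^ 2 ≤ ∑ k ∈ s, W.ψ (t - k) := by
        refine Finset.sum_le_sum fun k _ => ?_
        obtain ⟨h0, h1⟩ := W.ψ_mem (t - k)
        nlinarith
    _ ≤ 1 := sum_le_hasSum s (fun k _ => (W.ψ_mem _).1) (W.ψ_sum t)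

theorem enorm_sq_eq_ofReal (z : ℂ) : ‖z‖ₑ ^ 2 = ENNReal.ofReal (‖z‖ ^ 2) := by
  rw [ENNReal.ofReal_pow (norm_nonneg _), ofReal_norm]

/-- The wave packets of a function are almost orthogonal. -/
theorem exists_sum_lintegral_packetFreq_le :
    ∃ C : ℝ, 0 ≤ C ∧ ∀ (Γ : PlanarCurve) (ρ : ℝ) (h : E3 → ℂ), Measurable h → Integrable h →
      MemLp h 2 → ∀ 𝕋 : Finset TubeIndex,
      ∑ T ∈ 𝕋, ∫⁻ ξ, ‖packetFreq W Γ ρ h T ξ‖ₑ ^ 2 ≤ ENNReal.ofReal C * ∫⁻ ξ, ‖h ξ‖ₑ ^ 2 := by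
  obtain ⟨C, hC0, hC⟩ := exists_sum_pow_mul_norm_le W.η 0
  refine ⟨C ^ 2, by positivity, fun Γ ρ h hm hi h2 𝕋 => ?_⟩
  have hη : ∀ (y : E2) (s : Finset (ℤ × ℤ)),
      ∑ m ∈ s, ‖W.η (y - latticePoint m)‖ₑ ^ 2 ≤ ENNReal.ofReal (C ^ 2) := fun y s => by
    simp_rw [enorm_sq_eq_ofReal]
    rw [← ENNReal.ofReal_sum_of_nonneg fun _ _ => by positivity]
    refine ENNReal.ofReal_le_ofReal ?_
    have := hC y s
    simp only [pow_zero, one_mul] at this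
    exact (Finset.sum_sq_le_sq_sum_of_nonneg fun _ _ => norm_nonneg _).trans
      (pow_le_pow_left₀ (Finset.sum_nonneg fun _ _ => norm_nonneg _) this 2)
  set P : ℤ → E3 → ℂ := fun k => 𝓕⁻ (pieceFreq W Γ ρ k h)
  have hP : ∀ k, Measurable (P k) := fun k =>
    (continuous_fourierInv_of_integrable (integrable_pieceFreq W Γ ρ hm hi k)).measurable
  set K := 𝕋.image Prod.fst
  set M := 𝕋.image Prod.snd
  -- Enlarging to a product of directions and positions allows the positions of one direction to be
  -- summed pointwise in x; Plancherel then returns to frequency, where the squares of the ψ-cutoffs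
  -- sum to at most 1.
  have hsub : 𝕋 ⊆ K ×ˢ M := fun T hT => Finset.mem_product.2
    ⟨Finset.mem_image_of_mem _ hT, Finset.mem_image_of_mem _ hT⟩
  have hηm : ∀ k m, Measurable fun x => ‖W.η (Γ.crossCoord ρ k x - latticePoint m)‖ₑ ^ 2 :=
    fun k m => by
      have := continuous_crossCoord Γ ρ k
      have := W.η.continuous
      have : Continuous fun x => W.η (Γ.crossCoord ρ k x - latticePoint m) := by fun_prop
      exact this.measurable.enorm.pow_const 2
  calc ∑ T ∈ 𝕋, ∫⁻ ξ, ‖packetFreq W Γ ρ h T ξ‖ₑ ^ 2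
      ≤ ∑ T ∈ K ×ˢ M, ∫⁻ ξ, ‖packetFreq W Γ ρ h T ξ‖ₑ ^ 2 :=
        Finset.sum_le_sum_of_subset hsub
    _ = ∑ k ∈ K, ∫⁻ x, (∑ m ∈ M, ‖W.η (Γ.crossCoord ρ k x - latticePoint m)‖ₑ ^ 2) *
          ‖P k x‖ₑ ^ 2 := by
        rw [Finset.sum_product]
        refine Finset.sum_congr rfl fun k _ => ?_
        simp_rw [lintegral_enorm_sq_packetFreq W Γ ρ hm hi h2, Finset.sum_mul]
        rw [lintegral_finsetSum]
        exact fun m _ => (hηm k m).mul ((hP k).enorm.pow_const 2)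
    _ ≤ ∑ k ∈ K, ENNReal.ofReal (C ^ 2) * ∫⁻ x, ‖P k x‖ₑ ^ 2 := by
        refine Finset.sum_le_sum fun k _ => ?_
        rw [← lintegral_const_mul _ ((hP k).enorm.pow_const 2)]
        refine lintegral_mono fun x => ?_
        gcongr
        exact hη _ _
    _ = ENNReal.ofReal (C ^ 2) * ∫⁻ ξ, ∑ k ∈ K, ‖pieceFreq W Γ ρ k h ξ‖ₑ ^ 2 := by
        rw [← Finset.mul_sum, lintegral_finsetSum]
        · congr 1
          refine Finset.sum_congr rfl fun k _ => ?_
          exact lintegral_enorm_sq_fourierInv (integrable_pieceFreq W Γ ρ hm hi k)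
            (memLp_pieceFreq W Γ ρ hm h2 k)
        · exact fun k _ => (measurable_pieceFreq W Γ ρ hm k).enorm.pow_const 2
    _ ≤ _ := by
        gcongr with ξ
        simp_rw [enorm_sq_eq_ofReal]
        rw [← ENNReal.ofReal_sum_of_nonneg fun _ _ => by positivity]
        refine ENNReal.ofReal_le_ofReal ?_
        simp_rw [pieceFreq, norm_mul, mul_pow, ← Finset.sum_mul, Complex.norm_real, Real.norm_eq_abs,
          sq_abs]
        exact mul_le_of_le_one_left (by positivity) (sum_sq_profile_le W K _)

end Packets

/-! ### Frequency supports of functions, strips and packets. -/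

/-- `h` is a representative of the Fourier transform of `g` which vanishes off the
`R⁻¹`-neighbourhood of the part of the curve over `[s, t]`. -/
structure IsSpectrum (Γ : PlanarCurve) (R s t : ℝ) (g : Lp ℂ 2 (volume : Measure E3))
    (h : E3 → ℂ) : Prop where
  measurable : Measurable h
  integrable : Integrable h
  memLp : MemLp h 2
  support : ∀ ξ, h ξ ≠ 0 → ∃ x ∈ Icc s t, ‖ξ - Γ.point x‖ ≤ R⁻¹
  ae_eq : h =ᵐ[volume] (𝓕 g : Lp ℂ 2 (volume : Measure E3))
  lintegral_sq : ∫⁻ ξ, ‖h ξ‖ₑ ^ 2 = ENNReal.ofReal (‖g‖ ^ 2)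
  integral_norm_le : ∫ ξ, ‖h ξ‖ ≤ 8 * ‖g‖

theorem exists_isSpectrum {Γ : PlanarCurve} {A R s t : ℝ} (hΓ : Γ.IsCurved A) (hR : 1 ≤ R)
    (hs : Γ.a ≤ s) (ht : t ≤ Γ.b) {g : Lp ℂ 2 (volume : Measure E3)}
    (hg : FourierSupportedIn g (cthickening R⁻¹ (Γ.arc s t))) :
    ∃ h, IsSpectrum Γ R s t g h := by
  set N := cthickening R⁻¹ (Γ.arc s t)
  have hR' : R⁻¹ ≤ 1 := inv_le_one_of_one_le₀ hR
  have hN : MeasurableSet N := isClosed_cthickening.measurableSet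
  set f : E3 → ℂ := ((𝓕 g : Lp ℂ 2 (volume : Measure E3)) : E3 → ℂ) with hf
  have hfm : Measurable f := (Lp.stronglyMeasurable _).measurable
  have hf2 : MemLp f 2 := Lp.memLp _
  -- Truncating makes the support condition hold at every point, so that supports of convolutions
  -- can be computed pointwise.
  set h := N.indicator f with hh
  have hae : h =ᵐ[volume] f := by
    filter_upwards [hg] with ξ hξ
    by_cases hξN : ξ ∈ N
    · simp [hh, hξN]
    · simp [hh, hξN, f, hξ hξN]
  have hm : Measurable h := hfm.indicator hN
  have h2 : MemLp h 2 := hf2.indicator hN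
  have hsupp : ∀ ξ, h ξ ≠ 0 → ∃ x ∈ Icc s t, ‖ξ - Γ.point x‖ ≤ R⁻¹ := fun ξ hξ =>
    hΓ.mem_cthickening_arc (by positivity) (mem_of_indicator_ne_zero hξ)
  have hnorm : ∫⁻ ξ, ‖h ξ‖ₑ ^ 2 = ENNReal.ofReal (‖g‖ ^ 2) := by
    rw [lintegral_enorm_sq_eq_eLpNorm, eLpNorm_congr_ae hae, hf, ← Lp.enorm_def, ← ofReal_norm,
      Lp.norm_fourier_eq, ENNReal.ofReal_pow (norm_nonneg _)]
  have hball : {ξ | ‖h ξ‖ₑ ≠ 0} ⊆ closedBall (0 : E3) 2 := fun ξ hξ => by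
    obtain ⟨x, hx, hξx⟩ := hsupp ξ (by simpa using hξ)
    have h1 := hΓ.subset_ball x ⟨hs.trans hx.1, hx.2.trans ht⟩
    rw [mem_closedBall_zero_iff] at h1 ⊢
    linarith [norm_le_norm_sub_add ξ (Γ.point x)]
  have h1 : (∫⁻ ξ, ‖h ξ‖ₑ) ≤ ENNReal.ofReal (8 * ‖g‖) := by
    have e1 := sq_lintegral_le volume hm.enorm
    rw [hnorm] at e1
    -- The spectrum lies in a ball of radius 2, of volume at most 64; the square root gives the
    -- constant 8.
    have e2 : volume {ξ | ‖h ξ‖ₑ ≠ 0} ≤ ENNReal.ofReal 64 := by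
      refine (measure_mono hball).trans ?_
      rw [EuclideanSpace.volume_closedBall_fin_three, ← ENNReal.ofReal_pow (by norm_num),
        ← ENNReal.ofReal_mul (by norm_num)]
      exact ENNReal.ofReal_le_ofReal (by nlinarith [Real.pi_le_four])
    have e3 : (∫⁻ ξ, ‖h ξ‖ₑ) ^ 2 ≤ ENNReal.ofReal (8 * ‖g‖) ^ 2 := by
      refine e1.trans ((mul_le_mul_left e2 _).trans (le_of_eq ?_))
      rw [← ENNReal.ofReal_mul (by norm_num), ← ENNReal.ofReal_pow (by positivity)]
      congr 1; ring
    exact (ENNReal.pow_le_pow_left_iff two_ne_zero).1 e3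
  have hi : Integrable h := ⟨hm.aestronglyMeasurable, h1.trans_lt ENNReal.ofReal_lt_top⟩
  refine ⟨h, hm, hi, h2, hsupp, hae, hnorm, ?_⟩
  rw [integral_norm_eq_lintegral_enorm hm.aestronglyMeasurable]
  exact ENNReal.toReal_le_of_le_ofReal (by positivity) h1

namespace IsSpectrum

variable {Γ : PlanarCurve} {A R ρ s t : ℝ} {g : Lp ℂ 2 (volume : Measure E3)} {h : E3 → ℂ}

theorem ae_eq_fourierInv (hh : IsSpectrum Γ R s t g h) : (g : E3 → ℂ) =ᵐ[volume] 𝓕⁻ h := by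
  refine (lp_ae_eq_fourierInv g (hh.integrable.congr hh.ae_eq)).trans ?_
  exact Filter.Eventually.of_forall fun x => (Real.fourierInv_congr_ae hh.ae_eq x).symm

theorem norm_freqPiece_le (hh : IsSpectrum Γ R s t g h) (W : WavePacketProfile) (k : ℤ) (x : E3) :
    ‖𝓕⁻ (pieceFreq W Γ ρ k h) x‖ ≤ 8 * ‖g‖ := by
  refine (norm_fourierInv_le _ x).trans (le_trans ?_ hh.integral_norm_le)
  exact integral_mono (integrable_pieceFreq W Γ ρ hh.measurable hh.integrable k).norm
    hh.integrable.norm (norm_pieceFreq_le W Γ ρ k)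

/-- The strip has half-width 1 in units of ρ⁻¹; passing from ξ to a nearby curve point costs at most
ρ/R ≤ 1 more. -/
theorem pieceFreq_support (hh : IsSpectrum Γ R s t g h) (W : WavePacketProfile) (hR : 1 ≤ R)
    (hρ : 0 < ρ) (hρR : ρ ≤ R) {k : ℤ} {ξ : E3} (hξ : pieceFreq W Γ ρ k h ξ ≠ 0) :
    |ρ * ⟪Γ.frame 0, ξ⟫_ℝ - k| ≤ 1 ∧
      ∃ x ∈ Icc s t, ‖ξ - Γ.point x‖ ≤ R⁻¹ ∧ |ρ * x - k| ≤ 2 := by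
  have h1 : |ρ * ⟪Γ.frame 0, ξ⟫_ℝ - k| ≤ 1 := by
    by_contra! H
    exact hξ (by simp [pieceFreq, W.ψ_support _ H])
  obtain ⟨x, hx, hξx⟩ := hh.support ξ (right_ne_zero_of_mul hξ)
  refine ⟨h1, x, hx, hξx, ?_⟩
  have h2 : |⟪Γ.frame 0, ξ⟫_ℝ - x| ≤ R⁻¹ := by
    have := Γ.abs_inner_frame_le 0 (ξ - Γ.point x)
    rw [inner_sub_right, Γ.inner_frame_zero_point] at this
    exact this.trans hξx
  have h3 : ρ * |⟪Γ.frame 0, ξ⟫_ℝ - x| ≤ 1 := by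
    refine (mul_le_mul hρR h2 (abs_nonneg _) (by linarith)).trans (le_of_eq ?_)
    exact mul_inv_cancel₀ (by linarith)
  rw [← abs_of_pos hρ, ← abs_mul] at h3
  have h4 : ρ * x - k = (ρ * ⟪Γ.frame 0, ξ⟫_ℝ - k) - ρ * (⟪Γ.frame 0, ξ⟫_ℝ - x) := by ring
  rw [h4]
  refine (abs_sub _ _).trans ?_
  linarith

theorem pieceFreq_eq_zero (hh : IsSpectrum Γ R s t g h) (hΓ : Γ.IsCurved A)
    (hs : Γ.a ≤ s) (ht : t ≤ Γ.b) (W : WavePacketProfile) (hR : 1 ≤ R)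
    (hρ : 0 < ρ) (hρR : ρ ≤ R) {k : ℤ} (hk : ρ + 2 < |(k : ℝ)|) : pieceFreq W Γ ρ k h = 0 := by
  ext ξ
  by_contra H
  obtain ⟨-, x, hx, -, h2⟩ := hh.pieceFreq_support W hR hρ hρR H
  have h3 := hΓ.subset_ball x ⟨hs.trans hx.1, hx.2.trans ht⟩
  rw [mem_closedBall_zero_iff] at h3
  have h4 := (Γ.abs_inner_frame_le 0 (Γ.point x)).trans h3
  rw [Γ.inner_frame_zero_point] at h4
  have h5 : |ρ * x| ≤ ρ := by
    rw [abs_mul, abs_of_pos hρ]; exact mul_le_of_le_one_right hρ.le h4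
  have h6 : (k : ℝ) = ρ * x - (ρ * x - k) := by ring
  rw [h6] at hk
  linarith [abs_sub (ρ * x) (ρ * x - k)]

/-- The window shifts frequencies by at most ρ⁻¹, and only along directions orthogonal to the curve
normal at the node. The thickness in that normal direction is therefore R⁻¹ from the neighbourhood
plus A(2/ρ)² ≤ 4A/R from the curvature. -/
theorem packetFreq_support (hh : IsSpectrum Γ R s t g h) (hΓ : Γ.IsCurved A) (hA : 1 ≤ A)
    (hs : Γ.a ≤ s) (ht : t ≤ Γ.b) (W : WavePacketProfile) (hR : 1 ≤ R) (hρ : 0 < ρ)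
    (hρR : ρ ≤ R) (hRρ : R ≤ ρ ^ 2) {T : TubeIndex} {ξ : E3} (hξ : packetFreq W Γ ρ h T ξ ≠ 0) :
    |ρ * ⟪Γ.frame 0, ξ⟫_ℝ - T.1| ≤ 2 ∧ (∃ x ∈ Icc s t, ‖ξ - Γ.point x‖ ≤ 2 / ρ) ∧
      |⟪Γ.curveNormal (Γ.node ρ T.1), ξ⟫_ℝ -
        ⟪Γ.curveNormal (Γ.node ρ T.1), Γ.point (Γ.node ρ T.1)⟫_ℝ| ≤ 5 * A / R := by
  obtain ⟨ζ, hζ1, hζ2⟩ := exists_ne_zero_of_shearConv_ne_zero hξ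
  have hζ := norm_le_one_of_windowFreq_ne_zero W hζ1
  obtain ⟨h1, x, hx, hξx, hxk⟩ := hh.pieceFreq_support W hR hρ hρR hζ2
  set v := crossMap Γ ρ T.1 ζ with hv
  have hvn : ‖v‖ ≤ ρ⁻¹ := (norm_crossMap_le Γ hρ T.1 ζ).trans
    (mul_le_of_le_one_right (by positivity) hζ)
  have hR0 : 0 < R := by linarith
  refine ⟨?_, ⟨x, hx, ?_⟩, ?_⟩
  · have e1 : |ρ * ⟪Γ.frame 0, v⟫_ℝ| ≤ 1 := by
      rw [abs_mul, abs_of_pos hρ]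
      calc ρ * |⟪Γ.frame 0, v⟫_ℝ| ≤ ρ * ρ⁻¹ := by
            gcongr; exact (Γ.abs_inner_frame_le 0 v).trans hvn
        _ = 1 := mul_inv_cancel₀ hρ.ne'
    rw [inner_sub_right] at h1
    have e2 : ρ * ⟪Γ.frame 0, ξ⟫_ℝ - T.1 =
        (ρ * (⟪Γ.frame 0, ξ⟫_ℝ - ⟪Γ.frame 0, v⟫_ℝ) - T.1) + ρ * ⟪Γ.frame 0, v⟫_ℝ := by ring
    rw [e2]
    exact (abs_add_le _ _).trans (by linarith)
  · have e1 : ξ - Γ.point x = (ξ - v - Γ.point x) + v := by abel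
    rw [e1]
    refine (norm_add_le _ _).trans ?_
    have : R⁻¹ ≤ ρ⁻¹ := by gcongr
    calc _ ≤ ρ⁻¹ + ρ⁻¹ := by linarith
      _ = 2 / ρ := by ring
  · set ν := Γ.curveNormal (Γ.node ρ T.1)
    have e1 : ⟪ν, v⟫_ℝ = 0 := by
      rw [hv, crossMap_apply, real_inner_smul_right, inner_add_right, real_inner_smul_right,
        real_inner_smul_right, Γ.inner_curveNormal_tangent, Γ.inner_curveNormal_planeNormal]
      simp
    have hxm : x ∈ Icc Γ.a Γ.b := ⟨hs.trans hx.1, hx.2.trans ht⟩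
    have e2 := hΓ.abs_inner_curveNormal_le hA hxm (hΓ.node_mem ρ T.1)
    have e3 : |x - Γ.node ρ T.1| ≤ 2 / ρ := by
      refine (Γ.abs_sub_node_le hxm T.1).trans ?_
      have e : ρ * x - T.1 = (x - T.1 / ρ) * ρ := by field_simp
      rwa [e, abs_mul, abs_of_pos hρ, ← le_div_iff₀ hρ] at hxk
    have e4 : A * (x - Γ.node ρ T.1) ^ 2 ≤ 4 * A / R := by
      rw [← sq_abs]
      calc A * |x - Γ.node ρ T.1| ^ 2 ≤ A * (2 / ρ) ^ 2 := by gcongr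
        _ = 4 * A / ρ ^ 2 := by ring
        _ ≤ 4 * A / R := by gcongr
    have e5 : |⟪ν, ξ - v - Γ.point x⟫_ℝ| ≤ R⁻¹ := by
      refine (abs_real_inner_le_norm _ _).trans ?_
      rw [Γ.norm_curveNormal, one_mul]; exact hξx
    have e6 : ⟪ν, ξ⟫_ℝ - ⟪ν, Γ.point (Γ.node ρ T.1)⟫_ℝ = ⟪ν, ξ - v - Γ.point x⟫_ℝ +
        (⟪ν, Γ.point x⟫_ℝ - ⟪ν, Γ.point (Γ.node ρ T.1)⟫_ℝ) := by
      rw [inner_sub_right, inner_sub_right, e1]; ring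
    rw [e6]
    refine (abs_add_le _ _).trans ?_
    have e7 : R⁻¹ ≤ A / R := by rw [inv_eq_one_div]; gcongr
    calc _ ≤ A / R + 4 * A / R := by linarith
      _ = 5 * A / R := by ring

end IsSpectrum

/-! ### Decay of packets off their tubes. -/

theorem card_le_of_abs_sub_le {s : Finset ℤ} {y B : ℝ} (hB : 0 ≤ B)
    (hs : ∀ m ∈ s, |y - m| ≤ B) : (s.card : ℝ) ≤ 2 * B + 1 := by
  have h1 : s ⊆ Finset.Icc ⌈y - B⌉ ⌊y + B⌋ := fun m hm => by
    have := abs_le.1 (hs m hm)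
    exact Finset.mem_Icc.2 ⟨Int.ceil_le.2 (by linarith), Int.le_floor.2 (by linarith)⟩
  have h2 := Finset.card_le_card h1
  rw [Int.card_Icc] at h2
  have h3 : ((⌊y + B⌋ + 1 - ⌈y - B⌉).toNat : ℝ) ≤ 2 * B + 1 := by
    rw [← Int.cast_natCast, Int.toNat_eq_max]
    push_cast
    refine max_le ?_ (by linarith)
    linarith [Int.floor_le (y + B), Int.le_ceil (y - B)]
  exact le_trans (by exact_mod_cast h2) h3

/-- Off its tube a wave packet is rapidly decreasing, also after summation. -/
theorem exists_sum_norm_packet_le (W : WavePacketProfile) (N : ℕ) :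
    ∃ C : ℝ, 0 ≤ C ∧ ∀ (Γ : PlanarCurve) (A R ρ s t B : ℝ) (g : Lp ℂ 2 (volume : Measure E3))
      (h : E3 → ℂ), IsSpectrum Γ R s t g h → Γ.IsCurved A → Γ.a ≤ s → t ≤ Γ.b → 1 ≤ R →
      1 ≤ ρ → ρ ≤ R → 0 < B → ∀ (𝕋 : Finset TubeIndex) (x : E3),
      (∀ T ∈ 𝕋, B ≤ ‖Γ.crossCoord ρ T.1 x - latticePoint T.2‖) →
      ∑ T ∈ 𝕋, ‖𝓕⁻ (packetFreq W Γ ρ h T) x‖ ≤ C * R * (B ^ N)⁻¹ * ‖g‖ := by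
  obtain ⟨C, hC0, hC⟩ := exists_sum_pow_mul_norm_le W.η N
  refine ⟨C * 56, by positivity, fun Γ A R ρ s t B g h hh hΓ hs ht hR hρ hρR hB 𝕋 x hx => ?_⟩
  set e : ℤ → ℤ × ℤ → ℝ := fun k m => ‖Γ.crossCoord ρ k x - latticePoint m‖ ^ N *
    ‖W.η (Γ.crossCoord ρ k x - latticePoint m)‖
  -- The curve lies in the unit ball, so pieces with |k| > ρ + 2 vanish. Only O(R) directions
  -- remain, whatever the size of 𝕋.
  set K := (𝕋.image Prod.fst).filter fun k : ℤ => |(k : ℝ)| ≤ ρ + 2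
  set M := 𝕋.image Prod.snd
  have hcard : (K.card : ℝ) ≤ 7 * R := by
    have := card_le_of_abs_sub_le (s := K) (y := 0) (B := ρ + 2) (by linarith) fun m hm => by
      simpa using (Finset.mem_filter.1 hm).2
    linarith
  have hterm : ∀ T ∈ 𝕋, ‖𝓕⁻ (packetFreq W Γ ρ h T) x‖ ≤ (B ^ N)⁻¹ * (8 * ‖g‖) * e T.1 T.2 := by
    intro T hT
    rw [fourierInv_packetFreq W Γ ρ hh.measurable hh.integrable, norm_mul]
    have h1 : ‖W.η (Γ.crossCoord ρ T.1 x - latticePoint T.2)‖ ≤ (B ^ N)⁻¹ * e T.1 T.2 := by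
      rw [inv_mul_eq_div, le_div_iff₀ (by positivity), mul_comm]
      have := hx T hT
      simp only [e]
      gcongr
    calc _ ≤ (B ^ N)⁻¹ * e T.1 T.2 * (8 * ‖g‖) := by
          gcongr
          exact hh.norm_freqPiece_le W T.1 x
      _ = _ := by ring
  calc ∑ T ∈ 𝕋, ‖𝓕⁻ (packetFreq W Γ ρ h T) x‖
      = ∑ T ∈ 𝕋.filter (fun T => |(T.1 : ℝ)| ≤ ρ + 2), ‖𝓕⁻ (packetFreq W Γ ρ h T) x‖ := by
        symm
        refine Finset.sum_subset (Finset.filter_subset _ _) fun T hT hT' => ?_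
        have hk : ρ + 2 < |(T.1 : ℝ)| := by
          by_contra! H
          exact hT' (Finset.mem_filter.2 ⟨hT, H⟩)
        rw [fourierInv_packetFreq W Γ ρ hh.measurable hh.integrable,
          hh.pieceFreq_eq_zero hΓ hs ht W hR (by linarith) hρR hk]
        simp [Real.fourierInv_eq]
    _ ≤ ∑ T ∈ 𝕋.filter (fun T => |(T.1 : ℝ)| ≤ ρ + 2), (B ^ N)⁻¹ * (8 * ‖g‖) * e T.1 T.2 :=
        Finset.sum_le_sum fun T hT => hterm T (Finset.mem_filter.1 hT).1
    _ ≤ ∑ T ∈ K ×ˢ M, (B ^ N)⁻¹ * (8 * ‖g‖) * e T.1 T.2 := by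
        refine Finset.sum_le_sum_of_subset_of_nonneg (fun T hT => ?_) fun T _ _ => by positivity
        obtain ⟨h1, h2⟩ := Finset.mem_filter.1 hT
        exact Finset.mem_product.2 ⟨Finset.mem_filter.2 ⟨Finset.mem_image_of_mem _ h1, h2⟩,
          Finset.mem_image_of_mem _ h1⟩
    _ = ∑ k ∈ K, (B ^ N)⁻¹ * (8 * ‖g‖) * ∑ m ∈ M, e k m := by
        rw [Finset.sum_product]
        simp_rw [Finset.mul_sum]
    _ ≤ ∑ k ∈ K, (B ^ N)⁻¹ * (8 * ‖g‖) * C := by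
        refine Finset.sum_le_sum fun k _ => ?_
        gcongr
        exact hC _ _
    _ = K.card * ((B ^ N)⁻¹ * (8 * ‖g‖) * C) := by rw [Finset.sum_const, nsmul_eq_mul]
    _ ≤ 7 * R * ((B ^ N)⁻¹ * (8 * ‖g‖) * C) := by gcongr
    _ = _ := by ring

/-! ### Convolutions and the bilinear L² estimate. -/

section Convolution

variable {V : Type*} [NormedAddCommGroup V] [InnerProductSpace ℝ V] [FiniteDimensional ℝ V]
  [MeasurableSpace V] [BorelSpace V]

/-- Convolution, as a superposition of translates. -/
noncomputable abbrev conv (a h : V → ℂ) : V → ℂ := shearConv (ContinuousLinearMap.id ℝ V) a h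

theorem fourierInv_conv {a h : V → ℂ} (ha : Integrable a) (hh : Integrable h) (x : V) :
    𝓕⁻ (conv a h) x = 𝓕⁻ a x * 𝓕⁻ h x := by
  have e : (ContinuousLinearMap.id ℝ V).adjoint x = x :=
    ext_inner_left ℝ fun ζ => by rw [ContinuousLinearMap.adjoint_inner_right]; rfl
  rw [conv, fourierInv_shearConv _ ha hh, e]

theorem memLp_conv {a h : V → ℂ} (ha : Measurable a) (hh : Measurable h) (ha2 : MemLp a 2)
    (hh2 : MemLp h 2) (c : ℝ) (hc : ∀ ξ, volume {ζ | a ζ ≠ 0 ∧ h (ξ - ζ) ≠ 0} ≤ ENNReal.ofReal c) :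
    MemLp (conv a h) 2 := by
  refine memLp_two_of_lintegral_lt_top (measurable_shearConv _ ha hh) ?_
  refine (lintegral_enorm_sq_shearConv_le _ ha hh _ hc).trans_lt ?_
  exact ENNReal.mul_lt_top ENNReal.ofReal_lt_top
    (ENNReal.mul_lt_top (lintegral_enorm_sq_lt_top ha2) (lintegral_enorm_sq_lt_top hh2))

/-- The bilinear `L²` estimate for functions with transversal frequency supports. -/
theorem lintegral_enorm_sq_fourierInv_mul_le {a h : V → ℂ} (ha : Measurable a)
    (hh : Measurable h) (ha1 : Integrable a) (hh1 : Integrable h) (ha2 : MemLp a 2)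
    (hh2 : MemLp h 2) (c : ℝ) (hc : ∀ ξ, volume {ζ | a ζ ≠ 0 ∧ h (ξ - ζ) ≠ 0} ≤ ENNReal.ofReal c) :
    ∫⁻ x, ‖𝓕⁻ a x * 𝓕⁻ h x‖ₑ ^ 2 ≤
      ENNReal.ofReal c * ((∫⁻ ξ, ‖a ξ‖ₑ ^ 2) * ∫⁻ ξ, ‖h ξ‖ₑ ^ 2) := by
  simp_rw [← fourierInv_conv ha1 hh1]
  rw [lintegral_enorm_sq_fourierInv (integrable_shearConv _ ha1 hh1)
    (memLp_conv ha hh ha2 hh2 c hc)]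
  exact lintegral_enorm_sq_shearConv_le _ ha hh _ hc

theorem fourierInv_finset_sum {ι : Type*} (s : Finset ι) {f : ι → V → ℂ}
    (hf : ∀ i ∈ s, Integrable (f i)) (x : V) :
    𝓕⁻ (fun ξ => ∑ i ∈ s, f i ξ) x = ∑ i ∈ s, 𝓕⁻ (f i) x := by
  simp only [Real.fourierInv_eq, Finset.smul_sum]
  refine integral_finsetSum s fun i hi => ?_
  refine (hf i hi).mono ?_ (Filter.Eventually.of_forall fun ξ => by simp)
  exact (Real.continuous_fourierChar.comp (by fun_prop)).aestronglyMeasurable.smul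
    (hf i hi).aestronglyMeasurable

/-- Cauchy–Schwarz over the nonvanishing terms only: n bounds the overlap at a point, not the length
of the sum. -/
theorem enorm_sq_sum_le {ι : Type*} (s : Finset ι) (f : ι → ℂ) {n : ℝ}
    (hn : ((s.filter fun i => f i ≠ 0).card : ℝ) ≤ n) :
    ‖∑ i ∈ s, f i‖ₑ ^ 2 ≤ ENNReal.ofReal n * ∑ i ∈ s, ‖f i‖ₑ ^ 2 := by
  have hn0 : 0 ≤ n := (Nat.cast_nonneg _).trans hn
  simp_rw [enorm_sq_eq_ofReal]
  rw [← ENNReal.ofReal_sum_of_nonneg fun _ _ => by positivity, ← ENNReal.ofReal_mul hn0]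
  refine ENNReal.ofReal_le_ofReal ?_
  rw [← Finset.sum_filter_ne_zero]
  calc ‖∑ i ∈ s with f i ≠ 0, f i‖ ^ 2 ≤ (∑ i ∈ s with f i ≠ 0, ‖f i‖) ^ 2 := by
        gcongr; exact norm_sum_le _ _
    _ ≤ ((s.filter fun i => f i ≠ 0).card : ℝ) * ∑ i ∈ s with f i ≠ 0, ‖f i‖ ^ 2 :=
        sq_sum_le_card_mul_sum_sq
    _ ≤ n * ∑ i ∈ s, ‖f i‖ ^ 2 := by
        gcongr
        exact Finset.filter_subset _ _

end Convolution

/-! ### Cutoff to a ball with compact frequency support. -/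

section Cutoff

/-- The Fourier transform of a cutoff function to the ball of radius `1 / (6 r)` about `q`. -/
noncomputable def cutFreq (q : E3) (r : ℝ) : E3 → ℂ :=
  (ball (0 : E3) r).indicator fun ζ => ((𝐞 (-⟪ζ, q⟫_ℝ) : Circle) : ℂ)

theorem measurable_cutFreq (q : E3) (r : ℝ) : Measurable (cutFreq q r) :=
  Measurable.indicator (Continuous.measurable (by fun_prop)) measurableSet_ball

theorem norm_le_of_cutFreq_ne_zero {q ζ : E3} {r : ℝ} (h : cutFreq q r ζ ≠ 0) : ‖ζ‖ ≤ r := by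
  have := mem_of_indicator_ne_zero h
  rw [mem_ball_zero_iff] at this
  exact this.le

theorem lintegral_enorm_sq_cutFreq (q : E3) (r : ℝ) :
    ∫⁻ ζ, ‖cutFreq q r ζ‖ₑ ^ 2 = volume (ball (0 : E3) r) := by
  rw [← lintegral_indicator_one measurableSet_ball]
  congr 1; ext ζ
  by_cases h : ζ ∈ ball (0 : E3) r
  · simp only [cutFreq, indicator_of_mem h]
    rw [enorm_sq_eq_ofReal, Circle.norm_coe]; simp
  · simp [cutFreq, indicator_of_notMem h]

theorem integrable_cutFreq (q : E3) (r : ℝ) : Integrable (cutFreq q r) := by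
  rw [cutFreq, integrable_indicator_iff measurableSet_ball]
  refine Integrable.mono' (g := fun _ => 1) (integrableOn_const measure_ball_lt_top.ne)
    (Continuous.aestronglyMeasurable (by fun_prop)) (Filter.Eventually.of_forall fun ζ => (Circle.norm_coe _).le)

/-- At such x the phase 2π⟪ζ, x - q⟫ stays within π/3, so the real part of the integrand is at least
1/2. -/
theorem le_norm_fourierInv_cutFreq {q x : E3} {r : ℝ} (hx : r * ‖x - q‖ ≤ 1 / 6) :
    volume.real (ball (0 : E3) r) / 2 ≤ ‖𝓕⁻ (cutFreq q r) x‖ := by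
  have e1 : 𝓕⁻ (cutFreq q r) x = ∫ ζ in ball (0 : E3) r, ((𝐞 ⟪ζ, x - q⟫_ℝ : Circle) : ℂ) := by
    rw [Real.fourierInv_eq, ← integral_indicator measurableSet_ball]
    congr 1; ext ζ
    by_cases h : ζ ∈ ball (0 : E3) r
    · simp only [cutFreq, indicator_of_mem h, Circle.smul_def, smul_eq_mul]
      rw [← Circle.coe_mul, ← AddChar.map_add_eq_mul, inner_sub_right, ← sub_eq_add_neg]
    · simp [cutFreq, indicator_of_notMem h]
  have hi : IntegrableOn (fun ζ : E3 => ((𝐞 ⟪ζ, x - q⟫_ℝ : Circle) : ℂ)) (ball 0 r) :=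
    Integrable.mono' (g := fun _ => 1) (integrableOn_const measure_ball_lt_top.ne)
      (Continuous.aestronglyMeasurable (by fun_prop))
      (Filter.Eventually.of_forall fun ζ => (Circle.norm_coe _).le)
  refine le_trans ?_ (Complex.re_le_norm _)
  rw [e1]
  have e2 : (∫ ζ in ball (0 : E3) r, ((𝐞 ⟪ζ, x - q⟫_ℝ : Circle) : ℂ)).re
      = ∫ ζ in ball (0 : E3) r, ((𝐞 ⟪ζ, x - q⟫_ℝ : Circle) : ℂ).re :=
    (integral_re hi).symm
  rw [e2]
  calc volume.real (ball (0 : E3) r) / 2 = ∫ ζ in ball (0 : E3) r, (1 / 2 : ℝ) := by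
        rw [setIntegral_const, smul_eq_mul]; ring
    _ ≤ _ := by
        refine setIntegral_mono_on (integrableOn_const measure_ball_lt_top.ne) hi.re measurableSet_ball fun ζ hζ => ?_
        rw [mem_ball_zero_iff] at hζ
        rw [Real.fourierChar_apply, Complex.exp_ofReal_mul_I_re, ← Real.cos_pi_div_three,
          ← Real.cos_abs (2 * Real.pi * _)]
        have h1 : |⟪ζ, x - q⟫_ℝ| ≤ 1 / 6 := by
          refine (abs_real_inner_le_norm _ _).trans (le_trans ?_ hx)
          gcongr
        have h2 : |2 * Real.pi * ⟪ζ, x - q⟫_ℝ| ≤ Real.pi / 3 := by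
          rw [abs_mul, abs_of_pos (by positivity : 0 < 2 * Real.pi)]
          nlinarith [Real.pi_pos]
        exact Real.cos_le_cos_of_nonneg_of_le_pi (abs_nonneg _) (by linarith [Real.pi_pos]) h2

end Cutoff

/-! ### The bilinear estimate on one ball. -/

theorem volume_real_ball_three {r : ℝ} (hr : 0 ≤ r) :
    volume.real (ball (0 : E3) r) = r ^ 3 * (Real.pi * 4 / 3) := by
  rw [Measure.real, EuclideanSpace.volume_ball_fin_three, ← ENNReal.ofReal_pow hr,
    ← ENNReal.ofReal_mul (by positivity), ENNReal.toReal_ofReal (by positivity)]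

/-- An interval of length 6 leaves 7 directions, and each direction at most (2B + 1)² ≤ 9B²
positions. -/
theorem card_near_le {Γ : PlanarCurve} {ρ B y : ℝ} {q : E3} (hB : 1 ≤ B) {s : Finset TubeIndex}
    (h1 : ∀ T ∈ s, |y - T.1| ≤ 3)
    (h2 : ∀ T ∈ s, ‖Γ.crossCoord ρ T.1 q - latticePoint T.2‖ ≤ B) :
    (s.card : ℝ) ≤ 63 * B ^ 2 := by
  have hK : ((s.image Prod.fst).card : ℝ) ≤ 7 := by
    refine (card_le_of_abs_sub_le (y := y) (B := 3) (by norm_num) fun m hm => ?_).trans (by norm_num)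
    obtain ⟨T, hT, rfl⟩ := Finset.mem_image.1 hm
    exact h1 T hT
  have hfib : ∀ k ∈ s.image Prod.fst,
      (s.filter fun T => T.1 = k).card ≤ ⌊(3 * B) ^ 2⌋₊ := fun k _ => by
    refine Nat.le_floor ?_
    set F := s.filter fun T => T.1 = k
    have hF : ∀ T ∈ F, |Γ.crossCoord ρ k q 0 - T.2.1| ≤ B ∧ |Γ.crossCoord ρ k q 1 - T.2.2| ≤ B := by
      intro T hT
      obtain ⟨hTs, rfl⟩ := Finset.mem_filter.1 hT
      have h3 : ∀ i, ‖(Γ.crossCoord ρ T.1 q - latticePoint T.2) i‖ ≤ B := fun i =>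
        (PiLp.norm_apply_le _ i).trans (h2 T hTs)
      exact ⟨by simpa [latticePoint] using h3 0, by simpa [latticePoint] using h3 1⟩
    have hsub : F.card ≤ ((F.image fun T => T.2.1) ×ˢ (F.image fun T => T.2.2)).card := by
      refine Finset.card_le_card_of_injOn Prod.snd (fun T hT => ?_) fun T hT T' hT' h => ?_
      · exact Finset.mem_coe.2 (Finset.mem_product.2
          ⟨Finset.mem_image_of_mem (fun T : TubeIndex => T.2.1) hT,
            Finset.mem_image_of_mem (fun T : TubeIndex => T.2.2) hT⟩)
      · have e1 := (Finset.mem_filter.1 (Finset.mem_coe.1 hT)).2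
        have e2 := (Finset.mem_filter.1 (Finset.mem_coe.1 hT')).2
        exact Prod.ext (e1.trans e2.symm) h
    rw [Finset.card_product] at hsub
    have c1 : ((F.image fun T => T.2.1).card : ℝ) ≤ 2 * B + 1 :=
      card_le_of_abs_sub_le (y := Γ.crossCoord ρ k q 0) (by linarith) fun m hm => by
        obtain ⟨T, hT, rfl⟩ := Finset.mem_image.1 hm
        exact (hF T hT).1
    have c2 : ((F.image fun T => T.2.2).card : ℝ) ≤ 2 * B + 1 :=
      card_le_of_abs_sub_le (y := Γ.crossCoord ρ k q 1) (by linarith) fun m hm => by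
        obtain ⟨T, hT, rfl⟩ := Finset.mem_image.1 hm
        exact (hF T hT).2
    calc (F.card : ℝ) ≤ ((F.image fun T => T.2.1).card : ℝ) * (F.image fun T => T.2.2).card := by
          exact_mod_cast hsub
      _ ≤ (3 * B) * (3 * B) := by gcongr <;> linarith
      _ = (3 * B) ^ 2 := by ring
  have h3 := Finset.card_le_mul_card_image s _ hfib
  calc (s.card : ℝ) ≤ (⌊(3 * B) ^ 2⌋₊ : ℝ) * (s.image Prod.fst).card := by exact_mod_cast h3
    _ ≤ (3 * B) ^ 2 * 7 := by
        gcongr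
        exact Nat.floor_le (by positivity)
    _ = _ := by ring

/-- By `dist_le_of_sum_close` points of the fibre are within 34 A⁵ r of each other. It is used with
r = R⁻¹ on the whole space and with r = 3/ρ on balls. -/
theorem volume_sumset_fiber_le {Γ : PlanarCurve} {A r : ℝ} (hΓ : Γ.IsCurved A) (hA : 1 ≤ A)
    {s t : Fin 2 → ℝ} (hst : ∀ j, Γ.a ≤ s j ∧ s j ≤ t j ∧ t j ≤ Γ.b)
    (hsep : ∀ ξ ∈ Γ.arc (s 0) (t 0), ∀ ζ ∈ Γ.arc (s 1) (t 1), A⁻¹ ≤ dist ξ ζ)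
    {h : Fin 2 → E3 → ℂ}
    (hh : ∀ j ξ, h j ξ ≠ 0 → ∃ x ∈ Icc (s j) (t j), ‖ξ - Γ.point x‖ ≤ r) (ξ : E3) :
    volume {ζ | h 0 ζ ≠ 0 ∧ h 1 (ξ - ζ) ≠ 0} ≤ ENNReal.ofReal (8 * (34 * A ^ 5 * r) ^ 3) :=
  volume_le_of_pairwise_dist_le fun _ h1 _ h2 =>
    hΓ.dist_le_of_sum_close hA hst hsep (hh 0 _ h1.1) (hh 1 _ h1.2) (hh 0 _ h2.1) (hh 1 _ h2.2)

/-- The bilinear estimate for two functions with Fourier transforms near separated sub-curves. -/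
theorem lintegral_bilinear_le {Γ : PlanarCurve} {A R : ℝ} (hΓ : Γ.IsCurved A) (hA : 1 ≤ A)
    {s t : Fin 2 → ℝ} (hst : ∀ j, Γ.a ≤ s j ∧ s j ≤ t j ∧ t j ≤ Γ.b)
    (hsep : ∀ ξ ∈ Γ.arc (s 0) (t 0), ∀ ζ ∈ Γ.arc (s 1) (t 1), A⁻¹ ≤ dist ξ ζ)
    {g : Fin 2 → Lp ℂ 2 (volume : Measure E3)} {h : Fin 2 → E3 → ℂ}
    (hh : ∀ j, IsSpectrum Γ R (s j) (t j) (g j) (h j)) :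
    ∫⁻ x, ‖𝓕⁻ (h 0) x * 𝓕⁻ (h 1) x‖ₑ ^ 2 ≤
      ENNReal.ofReal (8 * (34 * A ^ 5 * R⁻¹) ^ 3 * (‖g 0‖ ^ 2 * ‖g 1‖ ^ 2)) := by
  refine (lintegral_enorm_sq_fourierInv_mul_le (hh 0).measurable (hh 1).measurable
    (hh 0).integrable (hh 1).integrable (hh 0).memLp (hh 1).memLp _
    (volume_sumset_fiber_le hΓ hA hst hsep (fun j => (hh j).support))).trans (le_of_eq ?_)
  rw [(hh 0).lintegral_sq, (hh 1).lintegral_sq, ← ENNReal.ofReal_mul (by positivity),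
    ← ENNReal.ofReal_mul' (by positivity)]

section Local

variable {Γ : PlanarCurve} {A R ρ s t B : ℝ} {g : Lp ℂ 2 (volume : Measure E3)} {h : E3 → ℂ}

/-- The frequency distribution of a sum of wave packets, cut off to a ball. -/
noncomputable def localFreq (W : WavePacketProfile) (Γ : PlanarCurve) (ρ : ℝ) (h : E3 → ℂ)
    (q : E3) (𝕋 : Finset TubeIndex) (ξ : E3) : ℂ :=
  ∑ T ∈ 𝕋, conv (cutFreq q (1 / (6 * ρ))) (packetFreq W Γ ρ h T) ξ

namespace IsSpectrum

/-- At a given ξ only the ζ in the r-ball that also lie in a slab of thickness about A/R contribute.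
Against the trivial volume r³ this saves A/(rR), which for r ~ ρ⁻¹ is Aρ/R: the share of a tube of
length R inside a ρ-ball. -/
theorem lintegral_conv_cutFreq_le (hh : IsSpectrum Γ R s t g h) (hΓ : Γ.IsCurved A) (hA : 1 ≤ A)
    (hs : Γ.a ≤ s) (ht : t ≤ Γ.b) (W : WavePacketProfile) (hR : 1 ≤ R) (hρ : 0 < ρ)
    (hρR : ρ ≤ R) (hRρ : R ≤ ρ ^ 2) (q : E3) {r : ℝ} (hr : 0 ≤ r) (T : TubeIndex) :
    ∫⁻ ξ, ‖conv (cutFreq q r) (packetFreq W Γ ρ h T) ξ‖ₑ ^ 2 ≤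
      ENNReal.ofReal (8 * r ^ 2 * (5 * A / R) * volume.real (ball (0 : E3) r)) *
        ∫⁻ ξ, ‖packetFreq W Γ ρ h T ξ‖ₑ ^ 2 := by
  set ν := Γ.curveNormal (Γ.node ρ T.1)
  refine (lintegral_enorm_sq_shearConv_le _ (measurable_cutFreq q r)
    (measurable_packetFreq W Γ ρ hh.measurable T)
    (ENNReal.ofReal (8 * r ^ 2 * (5 * A / R))) fun ξ => ?_).trans (le_of_eq ?_)
  · refine le_trans (measure_mono fun ζ hζ => ?_) (volume_ball_inter_slab_le
      (Γ.norm_curveNormal (Γ.node ρ T.1)) hr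
      (c := ⟪ν, ξ⟫_ℝ - ⟪ν, Γ.point (Γ.node ρ T.1)⟫_ℝ))
    refine ⟨norm_le_of_cutFreq_ne_zero hζ.1, ?_⟩
    have := (hh.packetFreq_support hΓ hA hs ht W hR hρ hρR hRρ hζ.2).2.2
    rw [ContinuousLinearMap.id_apply, inner_sub_right] at this
    rw [abs_sub_comm]
    refine le_trans (le_of_eq ?_) this
    congr 1; ring
  · rw [lintegral_enorm_sq_cutFreq, ← mul_assoc, ENNReal.ofReal_mul (q := volume.real _)
      (by positivity), ofReal_measureReal measure_ball_lt_top.ne]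

theorem integrable_conv_cutFreq (hh : IsSpectrum Γ R s t g h) (W : WavePacketProfile) (q : E3)
    (r : ℝ) (T : TubeIndex) : Integrable (conv (cutFreq q r) (packetFreq W Γ ρ h T)) :=
  integrable_shearConv _ (integrable_cutFreq q r)
    (integrable_packetFreq W Γ ρ hh.measurable hh.integrable T)

theorem measurable_localFreq (hh : IsSpectrum Γ R s t g h) (W : WavePacketProfile) (q : E3)
    (𝕋 : Finset TubeIndex) : Measurable (localFreq W Γ ρ h q 𝕋) :=
  Finset.measurable_fun_sum _ fun T _ => measurable_shearConv _ (measurable_cutFreq q _)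
    (measurable_packetFreq W Γ ρ hh.measurable T)

theorem integrable_localFreq (hh : IsSpectrum Γ R s t g h) (W : WavePacketProfile) (q : E3)
    (𝕋 : Finset TubeIndex) : Integrable (localFreq W Γ ρ h q 𝕋) :=
  integrable_finsetSum _ fun T _ => hh.integrable_conv_cutFreq W q _ T

theorem fourierInv_localFreq (hh : IsSpectrum Γ R s t g h) (W : WavePacketProfile) (q : E3)
    (𝕋 : Finset TubeIndex) (x : E3) : 𝓕⁻ (localFreq W Γ ρ h q 𝕋) x =
      𝓕⁻ (cutFreq q (1 / (6 * ρ))) x * ∑ T ∈ 𝕋, 𝓕⁻ (packetFreq W Γ ρ h T) x := by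
  rw [show localFreq W Γ ρ h q 𝕋 = fun ξ => ∑ T ∈ 𝕋, conv (cutFreq q (1 / (6 * ρ)))
    (packetFreq W Γ ρ h T) ξ from rfl, fourierInv_finset_sum 𝕋
    (fun T _ => hh.integrable_conv_cutFreq W q _ T), Finset.mul_sum]
  refine Finset.sum_congr rfl fun T _ => ?_
  rw [fourierInv_conv (integrable_cutFreq q _)
    (integrable_packetFreq W Γ ρ hh.measurable hh.integrable T)]

theorem conv_cutFreq_support (hh : IsSpectrum Γ R s t g h) (hΓ : Γ.IsCurved A) (hA : 1 ≤ A)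
    (hs : Γ.a ≤ s) (ht : t ≤ Γ.b) (W : WavePacketProfile) (hR : 1 ≤ R) (hρ : 0 < ρ)
    (hρR : ρ ≤ R) (hRρ : R ≤ ρ ^ 2) {q : E3} {T : TubeIndex} {ξ : E3}
    (hξ : conv (cutFreq q (1 / (6 * ρ))) (packetFreq W Γ ρ h T) ξ ≠ 0) :
    |ρ * ⟪Γ.frame 0, ξ⟫_ℝ - T.1| ≤ 3 ∧ ∃ x ∈ Icc s t, ‖ξ - Γ.point x‖ ≤ 3 / ρ := by
  obtain ⟨ζ, hζ1, hζ2⟩ := exists_ne_zero_of_shearConv_ne_zero hξ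
  have hζ := norm_le_of_cutFreq_ne_zero hζ1
  obtain ⟨h1, ⟨x, hx, h2⟩, -⟩ := hh.packetFreq_support hΓ hA hs ht W hR hρ hρR hRρ hζ2
  rw [ContinuousLinearMap.id_apply] at h1 h2
  have hζ' : ‖ζ‖ ≤ 1 / ρ := hζ.trans (by gcongr; linarith)
  constructor
  · have e1 : |ρ * ⟪Γ.frame 0, ζ⟫_ℝ| ≤ 1 := by
      rw [abs_mul, abs_of_pos hρ]
      calc ρ * |⟪Γ.frame 0, ζ⟫_ℝ| ≤ ρ * (1 / ρ) := by
            gcongr; exact (Γ.abs_inner_frame_le 0 ζ).trans hζ'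
        _ = 1 := by field_simp
    rw [inner_sub_right] at h1
    have e2 : ρ * ⟪Γ.frame 0, ξ⟫_ℝ - T.1 =
        (ρ * (⟪Γ.frame 0, ξ⟫_ℝ - ⟪Γ.frame 0, ζ⟫_ℝ) - T.1) + ρ * ⟪Γ.frame 0, ζ⟫_ℝ := by ring
    rw [e2]
    exact (abs_add_le _ _).trans (by linarith)
  · refine ⟨x, hx, ?_⟩
    have e1 : ξ - Γ.point x = (ξ - ζ - Γ.point x) + ζ := by abel
    rw [e1]
    refine (norm_add_le _ _).trans ?_
    calc _ ≤ 2 / ρ + 1 / ρ := by linarith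
      _ = 3 / ρ := by ring

theorem localFreq_support (hh : IsSpectrum Γ R s t g h) (hΓ : Γ.IsCurved A) (hA : 1 ≤ A)
    (hs : Γ.a ≤ s) (ht : t ≤ Γ.b) (W : WavePacketProfile) (hR : 1 ≤ R) (hρ : 0 < ρ)
    (hρR : ρ ≤ R) (hRρ : R ≤ ρ ^ 2) {q : E3} {𝕋 : Finset TubeIndex} {ξ : E3}
    (hξ : localFreq W Γ ρ h q 𝕋 ξ ≠ 0) : ∃ x ∈ Icc s t, ‖ξ - Γ.point x‖ ≤ 3 / ρ := by
  obtain ⟨T, -, hT⟩ := Finset.exists_ne_zero_of_sum_ne_zero hξ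
  exact (hh.conv_cutFreq_support hΓ hA hs ht W hR hρ hρR hRρ hT).2

/-- At each ξ only packets of boundedly many directions are nonzero, and those near q number O(B²);
so the square of the sum is controlled by the sum of squares. -/
theorem lintegral_localFreq_le (hh : IsSpectrum Γ R s t g h) (hΓ : Γ.IsCurved A) (hA : 1 ≤ A)
    (hs : Γ.a ≤ s) (ht : t ≤ Γ.b) (W : WavePacketProfile) (hR : 1 ≤ R) (hρ : 0 < ρ)
    (hρR : ρ ≤ R) (hRρ : R ≤ ρ ^ 2) (hB : 1 ≤ B) {q : E3} {𝕋 : Finset TubeIndex}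
    (hT : ∀ T ∈ 𝕋, ‖Γ.crossCoord ρ T.1 q - latticePoint T.2‖ ≤ B) :
    ∫⁻ ξ, ‖localFreq W Γ ρ h q 𝕋 ξ‖ₑ ^ 2 ≤
      ENNReal.ofReal (63 * B ^ 2 * (8 * (1 / (6 * ρ)) ^ 2 * (5 * A / R) *
        volume.real (ball (0 : E3) (1 / (6 * ρ))))) *
        ∑ T ∈ 𝕋, ∫⁻ ξ, ‖packetFreq W Γ ρ h T ξ‖ₑ ^ 2 := by
  have hm : ∀ T, Measurable fun ξ =>
      ‖conv (cutFreq q (1 / (6 * ρ))) (packetFreq W Γ ρ h T) ξ‖ₑ ^ 2 := fun T =>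
    (measurable_shearConv _ (measurable_cutFreq q _)
      (measurable_packetFreq W Γ ρ hh.measurable T)).enorm.pow_const 2
  calc ∫⁻ ξ, ‖localFreq W Γ ρ h q 𝕋 ξ‖ₑ ^ 2
      ≤ ∫⁻ ξ, ENNReal.ofReal (63 * B ^ 2) *
          ∑ T ∈ 𝕋, ‖conv (cutFreq q (1 / (6 * ρ))) (packetFreq W Γ ρ h T) ξ‖ₑ ^ 2 := by
        refine lintegral_mono fun ξ => enorm_sq_sum_le 𝕋 _ ?_
        refine card_near_le (Γ := Γ) (ρ := ρ) (q := q) (y := ρ * ⟪Γ.frame 0, ξ⟫_ℝ) hB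
          (fun T h1 => ?_) fun T h1 => hT T (Finset.mem_filter.1 h1).1
        exact (hh.conv_cutFreq_support hΓ hA hs ht W hR hρ hρR hRρ
          (Finset.mem_filter.1 h1).2).1
    _ = ENNReal.ofReal (63 * B ^ 2) * ∑ T ∈ 𝕋,
          ∫⁻ ξ, ‖conv (cutFreq q (1 / (6 * ρ))) (packetFreq W Γ ρ h T) ξ‖ₑ ^ 2 := by
        rw [lintegral_const_mul _ (Finset.measurable_fun_sum _ fun T _ => hm T),
          lintegral_finsetSum _ fun T _ => hm T]
    _ ≤ ENNReal.ofReal (63 * B ^ 2) * ∑ T ∈ 𝕋, ENNReal.ofReal (8 * (1 / (6 * ρ)) ^ 2 *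
          (5 * A / R) * volume.real (ball (0 : E3) (1 / (6 * ρ)))) *
          ∫⁻ ξ, ‖packetFreq W Γ ρ h T ξ‖ₑ ^ 2 := by
        gcongr with T _
        exact hh.lintegral_conv_cutFreq_le hΓ hA hs ht W hR hρ hρR hRρ q (by positivity) T
    _ = _ := by rw [← Finset.mul_sum, ← mul_assoc, ← ENNReal.ofReal_mul (by positivity)]

end IsSpectrum

end Local

theorem le_ofReal_div_mul {k c : ℝ} {x y : ℝ≥0∞} (hk : 0 < k)
    (h : ENNReal.ofReal k * x ≤ ENNReal.ofReal c * y) : x ≤ ENNReal.ofReal (c / k) * y := by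
  have h1 : ENNReal.ofReal k⁻¹ * ENNReal.ofReal k = 1 := by
    rw [← ENNReal.ofReal_mul (by positivity), inv_mul_cancel₀ hk.ne', ENNReal.ofReal_one]
  calc x = ENNReal.ofReal k⁻¹ * (ENNReal.ofReal k * x) := by rw [← mul_assoc, h1, one_mul]
    _ ≤ ENNReal.ofReal k⁻¹ * (ENNReal.ofReal c * y) := by gcongr
    _ = _ := by rw [← mul_assoc, ← ENNReal.ofReal_mul (by positivity), inv_mul_eq_div]

/-- The bilinear estimate on a ball of radius `ρ` for sums of wave packets whose tubes pass
near the ball. -/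
theorem lintegral_ball_packets_le {Γ : PlanarCurve} {A R ρ B : ℝ} (hΓ : Γ.IsCurved A)
    (hA : 1 ≤ A) {s t : Fin 2 → ℝ} (hst : ∀ j, Γ.a ≤ s j ∧ s j ≤ t j ∧ t j ≤ Γ.b)
    (hsep : ∀ ξ ∈ Γ.arc (s 0) (t 0), ∀ ζ ∈ Γ.arc (s 1) (t 1), A⁻¹ ≤ dist ξ ζ)
    {g : Fin 2 → Lp ℂ 2 (volume : Measure E3)} {h : Fin 2 → E3 → ℂ}
    (hh : ∀ j, IsSpectrum Γ R (s j) (t j) (g j) (h j)) (W : WavePacketProfile) (hR : 1 ≤ R)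
    (hρ : 0 < ρ) (hρR : ρ ≤ R) (hRρ : R ≤ ρ ^ 2) (hB : 1 ≤ B) {q : E3}
    {𝕋 : Fin 2 → Finset TubeIndex}
    (hT : ∀ j, ∀ T ∈ 𝕋 j, ‖Γ.crossCoord ρ T.1 q - latticePoint T.2‖ ≤ B) :
    ∫⁻ x in ball q ρ, ‖(∑ T ∈ 𝕋 0, 𝓕⁻ (packetFreq W Γ ρ (h 0) T) x) *
        ∑ T ∈ 𝕋 1, 𝓕⁻ (packetFreq W Γ ρ (h 1) T) x‖ₑ ^ 2 ≤
      ENNReal.ofReal (10 ^ 18 * A ^ 17 * B ^ 4 * ρ⁻¹ * (R ^ 2)⁻¹) *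
        ((∑ T ∈ 𝕋 0, ∫⁻ ξ, ‖packetFreq W Γ ρ (h 0) T ξ‖ₑ ^ 2) *
          ∑ T ∈ 𝕋 1, ∫⁻ ξ, ‖packetFreq W Γ ρ (h 1) T ξ‖ₑ ^ 2) := by
  -- The largest radius for which the cutoff is bounded below on the whole ball, as rρ = 1/6.
  set r := 1 / (6 * ρ) with hr
  have hr0 : 0 < r := by positivity
  set v := volume.real (ball (0 : E3) r) with hv
  have hv' : v = r ^ 3 * (Real.pi * 4 / 3) := volume_real_ball_three hr0.le
  have hv0 : 0 < v := by rw [hv']; positivity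
  set G : Fin 2 → E3 → ℂ := fun j => localFreq W Γ ρ (h j) q (𝕋 j)
  set f : Fin 2 → E3 → ℂ := fun j x => ∑ T ∈ 𝕋 j, 𝓕⁻ (packetFreq W Γ ρ (h j) T) x
  set a : Fin 2 → ℝ≥0∞ := fun j => ∑ T ∈ 𝕋 j, ∫⁻ ξ, ‖packetFreq W Γ ρ (h j) T ξ‖ₑ ^ 2
  set c := 63 * B ^ 2 * (8 * r ^ 2 * (5 * A / R) * v) with hc
  have hG : ∀ j, ∫⁻ ξ, ‖G j ξ‖ₑ ^ 2 ≤ ENNReal.ofReal c * a j := fun j =>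
    (hh j).lintegral_localFreq_le hΓ hA (hst j).1 (hst j).2.2 W hR hρ hρR hRρ hB (hT j)
  have hGm : ∀ j, Measurable (G j) := fun j => (hh j).measurable_localFreq W q _
  have hGi : ∀ j, Integrable (G j) := fun j => (hh j).integrable_localFreq W q _
  have hG2 : ∀ j, MemLp (G j) 2 := fun j => by
    refine memLp_two_of_lintegral_lt_top (hGm j) ((hG j).trans_lt ?_)
    refine ENNReal.mul_lt_top ENNReal.ofReal_lt_top (ENNReal.sum_lt_top.2 fun T _ => ?_)
    exact lintegral_enorm_sq_lt_top (memLp_packetFreq W Γ ρ (hh j).measurable (hh j).memLp T)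
  have hGs : ∀ j ξ, G j ξ ≠ 0 → ∃ x ∈ Icc (s j) (t j), ‖ξ - Γ.point x‖ ≤ 3 / ρ := fun j ξ hξ =>
    (hh j).localFreq_support hΓ hA (hst j).1 (hst j).2.2 W hR hρ hρR hRρ hξ
  have h1 := lintegral_enorm_sq_fourierInv_mul_le (hGm 0) (hGm 1) (hGi 0) (hGi 1) (hG2 0) (hG2 1) _
    (volume_sumset_fiber_le hΓ hA hst hsep hGs)
  -- On the ball each localized sum is at least v/2 times the original; two factors, squared, give
  -- (v/2)⁴.
  have h2 : ENNReal.ofReal ((v / 2) ^ 4) * ∫⁻ x in ball q ρ, ‖f 0 x * f 1 x‖ₑ ^ 2 ≤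
      ∫⁻ x, ‖𝓕⁻ (G 0) x * 𝓕⁻ (G 1) x‖ₑ ^ 2 := by
    refine le_trans ?_ (setLIntegral_le_lintegral (ball q ρ) _)
    rw [← lintegral_const_mul' _ _ ENNReal.ofReal_ne_top]
    refine setLIntegral_mono' measurableSet_ball fun x hx => ?_
    rw [enorm_sq_eq_ofReal, enorm_sq_eq_ofReal, ← ENNReal.ofReal_mul (by positivity)]
    refine ENNReal.ofReal_le_ofReal ?_
    have e : v / 2 ≤ ‖𝓕⁻ (cutFreq q r) x‖ := by
      refine le_norm_fourierInv_cutFreq ?_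
      rw [mem_ball, dist_eq_norm] at hx
      calc r * ‖x - q‖ ≤ r * ρ := by gcongr
        _ = 1 / 6 := by rw [hr]; field_simp
    simp only [G, (hh _).fourierInv_localFreq, norm_mul]
    calc _ = (v / 2 * ‖f 0 x‖ * (v / 2 * ‖f 1 x‖)) ^ 2 := by ring
      _ ≤ _ := by gcongr
  have h3 : ENNReal.ofReal ((v / 2) ^ 4) * ∫⁻ x in ball q ρ, ‖f 0 x * f 1 x‖ₑ ^ 2 ≤
      ENNReal.ofReal (8 * (34 * A ^ 5 * (3 / ρ)) ^ 3 * (c * c)) * (a 0 * a 1) := by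
    refine h2.trans (h1.trans ?_)
    have hc0 : 0 ≤ c := by positivity
    rw [ENNReal.ofReal_mul (q := c * c) (by positivity), ENNReal.ofReal_mul hc0]
    calc _ ≤ _ * ((ENNReal.ofReal c * a 0) * (ENNReal.ofReal c * a 1)) :=
          mul_le_mul_right (mul_le_mul' (hG 0) (hG 1)) _
      _ = _ := by ring
  refine (le_ofReal_div_mul (by positivity) h3).trans ?_
  gcongr
  rw [div_le_iff₀ (by positivity), hc]
  -- The fibre volume r³ times (r² v / R)² is r · r⁶ v² / R². Replacing r⁶ by v² cancels the factor
  -- v⁴ of the cutoffs and leaves r / R², comparable to ρ⁻¹R⁻².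
  have h4 : r ^ 6 ≤ v ^ 2 := by
    rw [hv', mul_pow, ← pow_mul]
    refine le_mul_of_one_le_right (by positivity) (one_le_pow₀ ?_)
    linarith [Real.pi_gt_three]
  have h5 : ρ⁻¹ = 6 * r := by rw [hr]; field_simp
  have h6 : (3 : ℝ) / ρ = 18 * r := by rw [hr]; field_simp; norm_num
  rw [h6, h5]
  have hR0 : (0 : ℝ) < R := by linarith
  calc _ = (8 * (34 * 18) ^ 3 * (63 * 8 * 5) ^ 2) * (A ^ 17 * B ^ 4 * (R ^ 2)⁻¹ * r * v ^ 2) * r ^ 6 := by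
        field_simp
    _ ≤ (10 ^ 18 * 6 / 16) * (A ^ 17 * B ^ 4 * (R ^ 2)⁻¹ * r * v ^ 2) * v ^ 2 := by
        gcongr; norm_num
    _ = _ := by ring

/-! ### Choosing one ball, and exponents. -/

/-- Pigeonholing √(ab), whose sum is at most √(αβ) by Cauchy–Schwarz, gives one index good for the
product; squaring the average gains the full factor |s|⁻². -/
theorem exists_mul_le_of_sum_le {ι : Type*} {s : Finset ι} (hs : s.Nonempty) {a b : ι → ℝ}
    (ha : ∀ i ∈ s, 0 ≤ a i) (hb : ∀ i ∈ s, 0 ≤ b i) {α β : ℝ} (hα : ∑ i ∈ s, a i ≤ α)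
    (hβ : ∑ i ∈ s, b i ≤ β) : ∃ i ∈ s, a i * b i ≤ ((s.card : ℝ) ^ 2)⁻¹ * (α * β) := by
  have hc : (0 : ℝ) < s.card := by exact_mod_cast hs.card_pos
  have h1 : ∑ i ∈ s, √(a i * b i) ≤ ∑ i ∈ s, (s.card : ℝ)⁻¹ * √(α * β) := by
    rw [Finset.sum_const, nsmul_eq_mul, ← mul_assoc, mul_inv_cancel₀ hc.ne', one_mul]
    refine Real.le_sqrt_of_sq_le ?_
    have h2 := Finset.sum_mul_sq_le_sq_mul_sq s (fun i => √(a i)) fun i => √(b i)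
    calc (∑ i ∈ s, √(a i * b i)) ^ 2 = (∑ i ∈ s, √(a i) * √(b i)) ^ 2 := by
          congr 1; exact Finset.sum_congr rfl fun i hi => Real.sqrt_mul (ha i hi) _
      _ ≤ _ := h2
      _ = (∑ i ∈ s, a i) * ∑ i ∈ s, b i := by
          congr 1 <;> exact Finset.sum_congr rfl fun i hi => Real.sq_sqrt (by simp_all)
      _ ≤ α * β := mul_le_mul hα hβ (Finset.sum_nonneg hb) ((Finset.sum_nonneg ha).trans hα)
  obtain ⟨i, hi, h⟩ := Finset.exists_le_of_sum_le hs h1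
  refine ⟨i, hi, ?_⟩
  have hαβ : 0 ≤ α * β :=
    mul_nonneg ((Finset.sum_nonneg ha).trans hα) ((Finset.sum_nonneg hb).trans hβ)
  have h3 := pow_le_pow_left₀ (Real.sqrt_nonneg _) h 2
  rwa [Real.sq_sqrt (mul_nonneg (ha i hi) (hb i hi)), mul_pow, Real.sq_sqrt hαβ, inv_pow] at h3

/-- Comparability of F turns the sum into |𝒬| R^δ F(q). The parameter X is |𝒬| or η², so one
computation of exponents serves both terms of the minimum. -/
theorem sum_le_of_ball_bound {ι : Type*} {𝒬 : Finset ι} {F : ι → ℝ} {q : ι}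
    (hq : q ∈ 𝒬) {R ρ δ p k X G n₀ n₁ : ℝ} (hR : 1 ≤ R) (hρ : 0 < ρ) (hp : 0 < p) (hp4 : p ≤ 4)
    (hδ : 0 < δ) (hk : 0 ≤ k) (hX : 0 ≤ X) (hn₀ : 0 ≤ n₀) (hn₁ : 0 ≤ n₁) (hG : 0 ≤ G)
    (hF : ∀ q' ∈ 𝒬, F q' ≤ R ^ δ * F q)
    (hFG : F q ≤ (8 * ρ ^ 3) ^ (1 - p / 4) * G ^ (p / 4))
    (hGX : G ≤ k * (R ^ δ) ^ 4 * (ρ⁻¹ * (R ^ 2)⁻¹ * ((𝒬.card : ℝ) ^ 2)⁻¹ * X *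
      (n₀ ^ 2 * n₁ ^ 2))) :
    ∑ q' ∈ 𝒬, F q' ≤ (8 ^ (1 - p / 4) * k ^ (p / 4)) * R ^ (5 * δ) * ρ ^ (3 - p) * R ^ (-(p / 2)) *
      (𝒬.card : ℝ) ^ (1 - p / 2) * X ^ (p / 4) * n₀ ^ (p / 2) * n₁ ^ (p / 2) := by
  set M : ℝ := (𝒬.card : ℝ)
  have hM : 0 < M := by
    have : 0 < 𝒬.card := Finset.card_pos.2 ⟨q, hq⟩
    exact Nat.cast_pos.2 this
  have hR0 : 0 < R := by linarith
  have hsq : ∀ {x : ℝ}, 0 ≤ x → (x ^ 2) ^ (p / 4) = x ^ (p / 2) := fun {x} hx => by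
    rw [← Real.rpow_natCast, ← Real.rpow_mul hx]; congr 1; push_cast; ring
  have h1 : G ^ (p / 4) ≤ k ^ (p / 4) * R ^ (p * δ) * (ρ ^ (-(p / 4)) * R ^ (-(p / 2)) *
      M ^ (-(p / 2)) * X ^ (p / 4) * (n₀ ^ (p / 2) * n₁ ^ (p / 2))) := by
    refine (Real.rpow_le_rpow hG hGX (by positivity)).trans (le_of_eq ?_)
    rw [Real.mul_rpow (by positivity) (by positivity), Real.mul_rpow hk (by positivity),
      Real.mul_rpow (by positivity) (by positivity), Real.mul_rpow (by positivity) hX,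
      Real.mul_rpow (by positivity) (by positivity), Real.mul_rpow (by positivity) (by positivity),
      Real.mul_rpow (by positivity) (by positivity), hsq hn₀, hsq hn₁,
      Real.inv_rpow (by positivity), Real.inv_rpow (by positivity), Real.inv_rpow (by positivity),
      hsq hR0.le, hsq hM.le, Real.rpow_neg hρ.le, Real.rpow_neg hR0.le, Real.rpow_neg hM.le,
      ← Real.rpow_natCast, ← Real.rpow_mul hR0.le, ← Real.rpow_mul hR0.le]
    congr 3
    push_cast; ring_nf
  have h2 : ∑ q' ∈ 𝒬, F q' ≤ M * (R ^ δ * F q) := by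
    refine (Finset.sum_le_sum hF).trans (le_of_eq ?_)
    rw [Finset.sum_const, nsmul_eq_mul]
  have h3 : (8 * ρ ^ 3) ^ (1 - p / 4) = 8 ^ (1 - p / 4) * ρ ^ (3 - 3 * p / 4) := by
    rw [Real.mul_rpow (by norm_num) (by positivity), ← Real.rpow_natCast, ← Real.rpow_mul hρ.le]
    congr 2; push_cast; ring
  rw [h3] at hFG
  calc ∑ q' ∈ 𝒬, F q' ≤ M * (R ^ δ * F q) := h2
    _ ≤ M * (R ^ δ * (8 ^ (1 - p / 4) * ρ ^ (3 - 3 * p / 4) * (k ^ (p / 4) * R ^ (p * δ) *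
          (ρ ^ (-(p / 4)) * R ^ (-(p / 2)) * M ^ (-(p / 2)) * X ^ (p / 4) *
          (n₀ ^ (p / 2) * n₁ ^ (p / 2)))))) := by
        gcongr
        exact hFG.trans (by gcongr)
    _ = (8 ^ (1 - p / 4) * k ^ (p / 4)) * (R ^ δ * R ^ (p * δ)) *
          (ρ ^ (3 - 3 * p / 4) * ρ ^ (-(p / 4))) * R ^ (-(p / 2)) *
          (M ^ (1 : ℝ) * M ^ (-(p / 2))) * X ^ (p / 4) * n₀ ^ (p / 2) * n₁ ^ (p / 2) := by
        rw [Real.rpow_one]; ring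
    _ ≤ _ := by
        rw [← Real.rpow_add hρ, ← Real.rpow_add hM, ← Real.rpow_add hR0]
        -- The origin of K = 5: one δ from the comparability of F, and pδ ≤ 4δ from the
        -- localization.
        have e1 : R ^ (δ + p * δ) ≤ R ^ (5 * δ) :=
          Real.rpow_le_rpow_of_exponent_le hR (by nlinarith)
        have e2 : 3 - 3 * p / 4 + -(p / 4) = 3 - p := by ring
        rw [e2, ← sub_eq_add_neg]
        gcongr

/-- Hölder's inequality on a ball. -/
theorem integral_ball_rpow_le {f : E3 → ℂ} (hf : AEStronglyMeasurable f) {q : E3} {ρ p : ℝ}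
    (hρ : 0 < ρ) (hp : 0 < p) (hp4 : p ≤ 4) (hfin : ∫⁻ x in ball q ρ, ‖f x‖ₑ ^ 2 ≠ ⊤) :
    ∫ x in ball q ρ, ‖f x‖ ^ (p / 2) ≤
      (8 * ρ ^ 3) ^ (1 - p / 4) * (∫⁻ x in ball q ρ, ‖f x‖ₑ ^ 2).toReal ^ (p / 4) := by
  set μ := (volume : Measure E3).restrict (ball q ρ)
  have hp2 : 0 < p / 2 := by positivity
  have h1 : ∫⁻ x, ‖f x‖ₑ ^ (p / 2) ∂μ ≤
      (∫⁻ x, ‖f x‖ₑ ^ 2 ∂μ) ^ (p / 4) * μ univ ^ (1 - p / 4) := by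
    have h2 := eLpNorm'_le_eLpNorm'_mul_rpow_measure_univ hp2 (by linarith : p / 2 ≤ 2)
      (hf.restrict : AEStronglyMeasurable f μ)
    simp only [eLpNorm'] at h2
    have h3 := ENNReal.rpow_le_rpow h2 hp2.le
    rw [ENNReal.mul_rpow_of_nonneg _ _ hp2.le, ← ENNReal.rpow_mul, ← ENNReal.rpow_mul,
      ← ENNReal.rpow_mul] at h3
    convert h3 using 2
    · rw [one_div, inv_mul_cancel₀ hp2.ne', ENNReal.rpow_one]
    · congr 1
      · simp [μ]
      · ring
    · congr 1; field_simp; ring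
  have hV : μ univ ≤ ENNReal.ofReal (8 * ρ ^ 3) := by
    rw [Measure.restrict_apply_univ, EuclideanSpace.volume_ball_fin_three,
      ← ENNReal.ofReal_pow hρ.le, ← ENNReal.ofReal_mul (by positivity)]
    refine ENNReal.ofReal_le_ofReal ?_
    nlinarith [Real.pi_le_four, pow_pos hρ 3]
  have h4 : ∫⁻ x, ‖f x‖ₑ ^ (p / 2) ∂μ ≤ ENNReal.ofReal ((8 * ρ ^ 3) ^ (1 - p / 4) *
      (∫⁻ x, ‖f x‖ₑ ^ 2 ∂μ).toReal ^ (p / 4)) := by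
    refine h1.trans ?_
    rw [mul_comm, ENNReal.ofReal_mul (by positivity),
      ← ENNReal.ofReal_rpow_of_nonneg ENNReal.toReal_nonneg (by positivity),
      ENNReal.ofReal_toReal hfin, ← ENNReal.ofReal_rpow_of_pos (by positivity)]
    gcongr
    linarith
  rw [integral_eq_lintegral_of_nonneg_ae (Filter.Eventually.of_forall fun x => by positivity)]
  · refine ENNReal.toReal_le_of_le_ofReal (by positivity) (le_trans (le_of_eq ?_) h4)
    congr 1; ext x
    rw [← ENNReal.ofReal_rpow_of_nonneg (norm_nonneg _) hp2.le, ofReal_norm]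
  · exact (hf.restrict.norm.aemeasurable.pow_const _).aestronglyMeasurable

/-! ### Reduction to the tubes meeting a ball, with error terms. -/

/-- Disjoint balls of radius at least 1 in an R-ball. The crude bound only serves to absorb error
terms. -/
theorem card_ballFamily_le {Γ : PlanarCurve} {ρ R c : ℝ} {x₀ : E3} {𝒬 : Finset E3} (hR : 0 < R)
    (hρ : 1 ≤ ρ) (h𝒬 : IsBallFamily ρ (Γ.slab ρ R c x₀) 𝒬) : (𝒬.card : ℝ) ≤ R ^ 3 := by
  have h1 : ∑ q ∈ 𝒬, volume (ball q ρ) ≤ volume (closedBall x₀ R) := by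
    rw [← measure_biUnion_finset h𝒬.1 fun q _ => measurableSet_ball]
    exact measure_mono (iUnion₂_subset fun q hq => (h𝒬.2 q hq).trans inter_subset_right)
  simp only [EuclideanSpace.volume_ball_fin_three, EuclideanSpace.volume_closedBall_fin_three,
    Finset.sum_const, nsmul_eq_mul] at h1
  rw [← ENNReal.ofReal_pow hR.le, ← ENNReal.ofReal_pow (by linarith), ← ENNReal.ofReal_natCast,
    ← ENNReal.ofReal_mul (by positivity), ← ENNReal.ofReal_mul (by positivity),
    ← ENNReal.ofReal_mul (by positivity), ENNReal.ofReal_le_ofReal_iff (by positivity),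
    ← mul_assoc] at h1
  have h2 := le_of_mul_le_mul_right h1 (by positivity)
  refine le_trans ?_ h2
  exact le_mul_of_one_le_right (by positivity) (one_le_pow₀ hρ)

theorem norm_mul_sq_le {z₀ z₁ f₀ f₁ : ℂ} {ε n₀ n₁ : ℝ} (hε : 0 ≤ ε) (hn₀ : 0 ≤ n₀)
    (h₀ : ‖z₀ - f₀‖ ≤ ε * n₀) (h₁ : ‖z₁ - f₁‖ ≤ ε * n₁)
    (hz₀ : ‖z₀‖ ≤ 8 * n₀) (hz₁ : ‖z₁‖ ≤ 8 * n₁) :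
    ‖z₀ * z₁‖ ^ 2 ≤ 2 * ‖f₀ * f₁‖ ^ 2 + 2 * ((16 + ε) * ε * (n₀ * n₁)) ^ 2 := by
  have hf : ‖f₀‖ ≤ (8 + ε) * n₀ := by
    have := norm_sub_norm_le f₀ z₀
    rw [norm_sub_rev] at this
    linarith
  have e : z₀ * z₁ = f₀ * f₁ + ((z₀ - f₀) * z₁ + f₀ * (z₁ - f₁)) := by ring
  have h2 : ‖(z₀ - f₀) * z₁ + f₀ * (z₁ - f₁)‖ ≤ (16 + ε) * ε * (n₀ * n₁) := by
    refine (norm_add_le _ _).trans ?_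
    rw [norm_mul, norm_mul]
    calc _ ≤ ε * n₀ * (8 * n₁) + (8 + ε) * n₀ * (ε * n₁) := by gcongr
      _ = _ := by ring
  have h3 : ‖z₀ * z₁‖ ≤ ‖f₀ * f₁‖ + (16 + ε) * ε * (n₀ * n₁) := by
    rw [e]
    exact (norm_add_le _ _).trans (by linarith)
  have h4 := pow_le_pow_left₀ (norm_nonneg _) h3 2
  nlinarith [sq_nonneg (‖f₀ * f₁‖ - (16 + ε) * ε * (n₀ * n₁))]

open Classical in
/-- The tubes of a family that meet the ball of radius `ρ` about `q`. -/
noncomputable def tubesMeeting (Γ : PlanarCurve) (ρ R δ : ℝ) (S : Set E3)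
    (𝕋 : Finset TubeIndex) (q : E3) : Finset TubeIndex :=
  𝕋.filter fun T => (ball q ρ ∩ tube Γ ρ R δ S T).Nonempty

/-- The energy of a wave packet. -/
noncomputable def packetEnergy (W : WavePacketProfile) (Γ : PlanarCurve) (ρ : ℝ) (h : E3 → ℂ)
    (T : TubeIndex) : ℝ :=
  (∫⁻ ξ, ‖packetFreq W Γ ρ h T ξ‖ₑ ^ 2).toReal

theorem packetEnergy_nonneg (W : WavePacketProfile) (Γ : PlanarCurve) (ρ : ℝ) (h : E3 → ℂ)
    (T : TubeIndex) : 0 ≤ packetEnergy W Γ ρ h T :=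
  ENNReal.toReal_nonneg

theorem IsSpectrum.sum_lintegral_eq {Γ : PlanarCurve} {R s t ρ : ℝ}
    {g : Lp ℂ 2 (volume : Measure E3)} {h : E3 → ℂ} (hh : IsSpectrum Γ R s t g h)
    (W : WavePacketProfile) (𝕋 : Finset TubeIndex) :
    ∑ T ∈ 𝕋, ∫⁻ ξ, ‖packetFreq W Γ ρ h T ξ‖ₑ ^ 2 =
      ENNReal.ofReal (∑ T ∈ 𝕋, packetEnergy W Γ ρ h T) := by
  rw [ENNReal.ofReal_sum_of_nonneg fun T _ => packetEnergy_nonneg W Γ ρ h T]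
  refine Finset.sum_congr rfl fun T _ => (ENNReal.ofReal_toReal ?_).symm
  exact (lintegral_enorm_sq_lt_top
    (memLp_packetFreq W Γ ρ hh.measurable hh.memLp T)).ne

theorem crossCoord_le_of_mem_tubesMeeting {Γ : PlanarCurve} {ρ R δ : ℝ} {S : Set E3}
    {𝕋 : Finset TubeIndex} {q : E3} (hρ : 0 < ρ) (hRδ : 1 ≤ R ^ δ) {T : TubeIndex}
    (hT : T ∈ tubesMeeting Γ ρ R δ S 𝕋 q) :
    ‖Γ.crossCoord ρ T.1 q - latticePoint T.2‖ ≤ 2 * R ^ δ := by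
  classical
  obtain ⟨x, hx, -, hx'⟩ := (Finset.mem_filter.1 hT).2
  rw [mem_ball', dist_eq_norm] at hx
  have h1 : ‖Γ.crossCoord ρ T.1 q - Γ.crossCoord ρ T.1 x‖ ≤ 1 := by
    refine (norm_crossCoord_sub_le Γ hρ T.1 q x).trans ?_
    rw [inv_mul_le_iff₀ hρ, mul_one]; exact hx.le
  calc _ ≤ ‖Γ.crossCoord ρ T.1 q - Γ.crossCoord ρ T.1 x‖ +
        ‖Γ.crossCoord ρ T.1 x - latticePoint T.2‖ := norm_sub_le_norm_sub_add_norm_sub _ _ _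
    _ ≤ 2 * R ^ δ := by linarith

/-- On a ball, a function is the sum of the wave packets whose tubes meet the ball, up to a
rapidly decreasing error. -/
theorem exists_ae_norm_sub_sum_le (W : WavePacketProfile) (D : ℕ → ℝ) {δ : ℝ} (hδ : 0 < δ) :
    ∃ E : ℝ, 0 ≤ E ∧ ∀ (Γ : PlanarCurve) (A R ρ s t c : ℝ) (x₀ : E3)
      (g : Lp ℂ 2 (volume : Measure E3)) (h : E3 → ℂ) (𝕋 : Finset TubeIndex) (q : E3),
      IsSpectrum Γ R s t g h → Γ.IsCurved A → Γ.a ≤ s → t ≤ Γ.b → 1 ≤ R → 1 ≤ ρ → ρ ≤ R →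
      DecomposesOn W Γ ρ R D (Γ.slab ρ R c x₀) 𝕋 g → ball q ρ ⊆ Γ.slab ρ R c x₀ →
      ∀ᵐ x ∂(volume.restrict (ball q ρ)),
        ‖g x - ∑ T ∈ tubesMeeting Γ ρ R δ (Γ.slab ρ R c x₀) 𝕋 q, 𝓕⁻ (packetFreq W Γ ρ h T) x‖ ≤
          E * (R ^ 6)⁻¹ * ‖g‖ := by
  classical
  -- Off its tube a packet gains (R^δ)^N ≥ R⁷; one power of R is lost to the number of directions,
  -- leaving R⁻⁶.
  obtain ⟨C, hC0, hC⟩ := exists_sum_norm_packet_le W ⌈7 / δ⌉₊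
  refine ⟨|D 6| + C, by positivity,
    fun Γ A R ρ s t c x₀ g h 𝕋 q hh hΓ hs ht hR hρ hρR hdec hq => ?_⟩
  have hR0 : 0 < R := by linarith
  set S := Γ.slab ρ R c x₀
  have h1 := ae_restrict_of_ae_restrict_of_subset hq (hdec 6)
  filter_upwards [h1, ae_restrict_mem measurableSet_ball] with x hx hxq
  have h2 : ‖g x - ∑ T ∈ 𝕋, 𝓕⁻ (packetFreq W Γ ρ h T) x‖ ≤ |D 6| * (R ^ 6)⁻¹ * ‖g‖ := by
    simp_rw [← wavePacket_eq_fourierInv W Γ ρ hh.measurable hh.integrable hh.ae_eq]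
    refine hx.trans ?_
    rw [Real.rpow_neg hR0.le, Real.rpow_natCast]
    gcongr
    exact le_abs_self _
  have h3 : ‖∑ T ∈ 𝕋.filter (fun T => ¬ (ball q ρ ∩ tube Γ ρ R δ S T).Nonempty),
      𝓕⁻ (packetFreq W Γ ρ h T) x‖ ≤ C * (R ^ 6)⁻¹ * ‖g‖ := by
    refine (norm_sum_le _ _).trans ((hC Γ A R ρ s t (R ^ δ) g h hh hΓ hs ht hR hρ hρR
      (by positivity) _ x fun T hT => ?_).trans ?_)
    · by_contra! H
      exact (Finset.mem_filter.1 hT).2 ⟨x, hxq, hq hxq, H.le⟩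
    · have h4 : R ^ 7 ≤ (R ^ δ) ^ ⌈7 / δ⌉₊ := by
        rw [← Real.rpow_natCast, ← Real.rpow_natCast, ← Real.rpow_mul hR0.le]
        refine Real.rpow_le_rpow_of_exponent_le hR ?_
        have := Nat.le_ceil (7 / δ)
        rw [div_le_iff₀ hδ] at this
        push_cast
        linarith
      have h5 : R * ((R ^ δ) ^ ⌈7 / δ⌉₊)⁻¹ ≤ (R ^ 6)⁻¹ := by
        calc R * ((R ^ δ) ^ ⌈7 / δ⌉₊)⁻¹ ≤ R * (R ^ 7)⁻¹ := by gcongr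
          _ = (R ^ 6)⁻¹ := by field_simp
      rw [mul_assoc C]
      gcongr
  have h6 : g x - ∑ T ∈ tubesMeeting Γ ρ R δ S 𝕋 q, 𝓕⁻ (packetFreq W Γ ρ h T) x =
      (g x - ∑ T ∈ 𝕋, 𝓕⁻ (packetFreq W Γ ρ h T) x) +
      ∑ T ∈ 𝕋.filter (fun T => ¬ (ball q ρ ∩ tube Γ ρ R δ S T).Nonempty),
        𝓕⁻ (packetFreq W Γ ρ h T) x := by
    rw [← Finset.sum_filter_add_sum_filter_not 𝕋
      (fun T => (ball q ρ ∩ tube Γ ρ R δ S T).Nonempty), tubesMeeting]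
    ring
  rw [h6]
  refine (norm_add_le _ _).trans ?_
  linarith

/-- The bilinear estimate on a ball in terms of the wave packets whose tubes meet it. -/
theorem exists_lintegral_ball_le (W : WavePacketProfile) (D : ℕ → ℝ) {A δ : ℝ} (hA : 1 ≤ A)
    (hδ : 0 < δ) :
    ∃ k : ℝ, 0 ≤ k ∧ ∀ (Γ : PlanarCurve) (R ρ c : ℝ) (x₀ : E3) (s t : Fin 2 → ℝ)
      (g : Fin 2 → Lp ℂ 2 (volume : Measure E3)) (h : Fin 2 → E3 → ℂ)
      (𝕋 : Fin 2 → Finset TubeIndex) (q : E3),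
      (∀ j, IsSpectrum Γ R (s j) (t j) (g j) (h j)) → Γ.IsCurved A →
      (∀ j, Γ.a ≤ s j ∧ s j ≤ t j ∧ t j ≤ Γ.b) →
      (∀ ξ ∈ Γ.arc (s 0) (t 0), ∀ ζ ∈ Γ.arc (s 1) (t 1), A⁻¹ ≤ dist ξ ζ) →
      1 ≤ R → 1 ≤ ρ → ρ ≤ R → R ≤ ρ ^ 2 →
      (∀ j, DecomposesOn W Γ ρ R D (Γ.slab ρ R c x₀) (𝕋 j) (g j)) →
      ball q ρ ⊆ Γ.slab ρ R c x₀ →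
      ∫⁻ x in ball q ρ, ‖g 0 x * g 1 x‖ₑ ^ 2 ≤ ENNReal.ofReal
        (k * (R ^ δ) ^ 4 * (ρ⁻¹ * (R ^ 2)⁻¹) *
          ((∑ T ∈ tubesMeeting Γ ρ R δ (Γ.slab ρ R c x₀) (𝕋 0) q, packetEnergy W Γ ρ (h 0) T) *
          ∑ T ∈ tubesMeeting Γ ρ R δ (Γ.slab ρ R c x₀) (𝕋 1) q, packetEnergy W Γ ρ (h 1) T) +
          k * (R ^ 9)⁻¹ * (‖g 0‖ ^ 2 * ‖g 1‖ ^ 2)) := by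
  obtain ⟨E, hE0, hE⟩ := exists_ae_norm_sub_sum_le W D hδ
  set k₁ : ℝ := 32 * (10 ^ 18 * A ^ 17)
  set k₂ : ℝ := 16 * ((16 + E) * E) ^ 2
  refine ⟨k₁ + k₂, by positivity, fun Γ R ρ c x₀ s t g h 𝕋 q hh hΓ hst hsep hR hρ hρR hRρ hdec hq => ?_⟩
  have hR0 : 0 < R := by linarith
  have hρ0 : 0 < ρ := by linarith
  have hRδ : 1 ≤ R ^ δ := Real.one_le_rpow hR hδ.le
  set S := Γ.slab ρ R c x₀
  set 𝕌 : Fin 2 → Finset TubeIndex := fun j => tubesMeeting Γ ρ R δ S (𝕋 j) q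
  set f : Fin 2 → E3 → ℂ := fun j x => ∑ T ∈ 𝕌 j, 𝓕⁻ (packetFreq W Γ ρ (h j) T) x
  set a : Fin 2 → ℝ := fun j => ∑ T ∈ 𝕌 j, packetEnergy W Γ ρ (h j) T
  have ha : ∀ j, 0 ≤ a j := fun j => Finset.sum_nonneg fun T _ => packetEnergy_nonneg _ _ _ _ _
  have h1 : ∫⁻ x in ball q ρ, ‖f 0 x * f 1 x‖ₑ ^ 2 ≤
      ENNReal.ofReal (10 ^ 18 * A ^ 17 * (2 * R ^ δ) ^ 4 * ρ⁻¹ * (R ^ 2)⁻¹ * (a 0 * a 1)) := by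
    refine (lintegral_ball_packets_le hΓ hA hst hsep hh W hR hρ0 hρR hRρ (by linarith)
      (fun j T hT => crossCoord_le_of_mem_tubesMeeting (𝕋 := 𝕋 j) hρ0 hRδ hT)).trans (le_of_eq ?_)
    rw [(hh 0).sum_lintegral_eq, (hh 1).sum_lintegral_eq, ← ENNReal.ofReal_mul (ha 0),
      ← ENNReal.ofReal_mul (by positivity)]
  set ε := E * (R ^ 6)⁻¹ with hε
  set e : ℝ := 2 * ((16 + ε) * ε * (‖g 0‖ * ‖g 1‖)) ^ 2 with he
  have h2 : ∀ᵐ x ∂(volume.restrict (ball q ρ)),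
      ‖g 0 x * g 1 x‖ₑ ^ 2 ≤
        ENNReal.ofReal 2 * ‖f 0 x * f 1 x‖ₑ ^ 2 + ENNReal.ofReal e := by
    have hb : ∀ j, ∀ᵐ x ∂(volume.restrict (ball q ρ)), ‖g j x‖ ≤ 8 * ‖g j‖ := fun j => by
      filter_upwards [ae_restrict_of_ae (hh j).ae_eq_fourierInv] with x hx
      rw [hx]
      exact (norm_fourierInv_le _ x).trans (hh j).integral_norm_le
    have hd := fun j => hE Γ A R ρ (s j) (t j) c x₀ (g j) (h j) (𝕋 j) q (hh j) hΓ (hst j).1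
      (hst j).2.2 hR hρ hρR (hdec j) hq
    filter_upwards [hb 0, hb 1, hd 0, hd 1] with x b0 b1 d0 d1
    have := norm_mul_sq_le (by positivity) (norm_nonneg _) d0 d1 b0 b1
    rw [enorm_sq_eq_ofReal, enorm_sq_eq_ofReal,
      ← ENNReal.ofReal_mul (by norm_num), ← ENNReal.ofReal_add (by positivity) (by positivity)]
    exact ENNReal.ofReal_le_ofReal this
  have hV : volume (ball q ρ) ≤ ENNReal.ofReal (8 * R ^ 3) := by
    rw [EuclideanSpace.volume_ball_fin_three, ← ENNReal.ofReal_pow hρ0.le,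
      ← ENNReal.ofReal_mul (by positivity)]
    refine ENNReal.ofReal_le_ofReal ?_
    have := Real.pi_le_four
    calc ρ ^ 3 * (Real.pi * 4 / 3) ≤ R ^ 3 * 8 := by gcongr; linarith
      _ = 8 * R ^ 3 := by ring
  -- The squared error is O(R⁻¹²), and the ball has volume O(R³).
  have hεR : e * (8 * R ^ 3) ≤ k₂ * (R ^ 9)⁻¹ * (‖g 0‖ ^ 2 * ‖g 1‖ ^ 2) := by
    have hεE : ε ≤ E := mul_le_of_le_one_right hE0 (inv_le_one_of_one_le₀ (one_le_pow₀ hR))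
    calc e * (8 * R ^ 3) = 16 * ((16 + ε) * E) ^ 2 * (R ^ 9)⁻¹ * (‖g 0‖ ^ 2 * ‖g 1‖ ^ 2) := by
          rw [he, hε]; field_simp; ring
      _ ≤ _ := by simp only [k₂]; gcongr
  calc ∫⁻ x in ball q ρ, ‖g 0 x * g 1 x‖ₑ ^ 2
      ≤ ∫⁻ x in ball q ρ, (ENNReal.ofReal 2 * ‖f 0 x * f 1 x‖ₑ ^ 2 + ENNReal.ofReal e) :=
        lintegral_mono_ae h2
    _ = ENNReal.ofReal 2 * (∫⁻ x in ball q ρ, ‖f 0 x * f 1 x‖ₑ ^ 2)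
          + ENNReal.ofReal e * volume (ball q ρ) := by
        rw [lintegral_add_right _ measurable_const, lintegral_const_mul' _ _ ENNReal.ofReal_ne_top,
          setLIntegral_const]
    _ ≤ ENNReal.ofReal 2 * ENNReal.ofReal
          (10 ^ 18 * A ^ 17 * (2 * R ^ δ) ^ 4 * ρ⁻¹ * (R ^ 2)⁻¹ * (a 0 * a 1)) +
          ENNReal.ofReal e * ENNReal.ofReal (8 * R ^ 3) := by
        gcongr
    _ ≤ _ := by
        have ha01 := mul_nonneg (ha 0) (ha 1)
        rw [← ENNReal.ofReal_mul (by norm_num), ← ENNReal.ofReal_mul (by positivity),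
          ← ENNReal.ofReal_add (by positivity) (by positivity)]
        refine ENNReal.ofReal_le_ofReal (add_le_add ?_ (hεR.trans ?_))
        · calc _ = k₁ * (R ^ δ) ^ 4 * (ρ⁻¹ * (R ^ 2)⁻¹) * (a 0 * a 1) := by simp only [k₁]; ring
            _ ≤ (k₁ + k₂) * (R ^ δ) ^ 4 * (ρ⁻¹ * (R ^ 2)⁻¹) * (a 0 * a 1) := by
              gcongr; exact le_add_of_nonneg_right (by positivity)
        · gcongr; exact le_add_of_nonneg_left (by positivity)

/-- Double counting of the incidences between balls and tubes. -/
theorem sum_sum_tubesMeeting_le {Γ : PlanarCurve} {ρ R δ H : ℝ} {S : Set E3}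
    {𝕋 : Finset TubeIndex} {𝒬 : Finset E3} {b : TubeIndex → ℝ} (hb : ∀ T, 0 ≤ b T)
    (hinc : ∀ T ∈ 𝕋, (incidence ρ 𝒬 (tube Γ ρ R δ S T) : ℝ) ≤ H) :
    ∑ q ∈ 𝒬, ∑ T ∈ tubesMeeting Γ ρ R δ S 𝕋 q, b T ≤ H * ∑ T ∈ 𝕋, b T := by
  classical
  simp only [tubesMeeting, Finset.sum_filter]
  rw [Finset.sum_comm, Finset.mul_sum]
  refine Finset.sum_le_sum fun T hT => ?_
  rw [← Finset.sum_filter, Finset.sum_const, nsmul_eq_mul]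
  refine mul_le_mul_of_nonneg_right (le_trans (le_of_eq ?_) (hinc T hT)) (hb T)
  rw [incidence, ← Set.ncard_coe_finset]
  congr 2; ext q; simp

/-! ### Averaging over the balls. -/

section Assembly

variable {W : WavePacketProfile} {D : ℕ → ℝ} {A R ρ δ η c : ℝ} {x₀ : E3} {Γ : PlanarCurve}
  {s t : Fin 2 → ℝ} {g : Fin 2 → Lp ℂ 2 (volume : Measure E3)} {h : Fin 2 → E3 → ℂ}
  {𝕋 : Fin 2 → Finset TubeIndex} {𝒬 : Finset E3}

/-- The global bilinear estimate, summed over disjoint balls. -/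
theorem sum_lintegral_ball_le (hΓ : Γ.IsCurved A) (hA : 1 ≤ A)
    (hst : ∀ j, Γ.a ≤ s j ∧ s j ≤ t j ∧ t j ≤ Γ.b)
    (hsep : ∀ ξ ∈ Γ.arc (s 0) (t 0), ∀ ζ ∈ Γ.arc (s 1) (t 1), A⁻¹ ≤ dist ξ ζ)
    (hh : ∀ j, IsSpectrum Γ R (s j) (t j) (g j) (h j))
    (h𝒬 : (𝒬 : Set E3).PairwiseDisjoint fun q => ball q ρ) :
    ∑ q ∈ 𝒬, ∫⁻ x in ball q ρ, ‖g 0 x * g 1 x‖ₑ ^ 2 ≤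
      ENNReal.ofReal (8 * (34 * A ^ 5 * R⁻¹) ^ 3 * (‖g 0‖ ^ 2 * ‖g 1‖ ^ 2)) := by
  rw [← lintegral_biUnion_finset h𝒬 fun q _ => measurableSet_ball]
  refine (setLIntegral_le_lintegral _ _).trans (le_trans (le_of_eq ?_)
    (lintegral_bilinear_le hΓ hA hst hsep hh))
  refine lintegral_congr_ae ?_
  filter_upwards [(hh 0).ae_eq_fourierInv, (hh 1).ae_eq_fourierInv] with x h0 h1
  rw [h0, h1]

/-- Some ball carries at most the average of the bilinear `L²` estimate. -/
theorem exists_ball_le_average (hΓ : Γ.IsCurved A) (hA : 1 ≤ A)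
    (hst : ∀ j, Γ.a ≤ s j ∧ s j ≤ t j ∧ t j ≤ Γ.b)
    (hsep : ∀ ξ ∈ Γ.arc (s 0) (t 0), ∀ ζ ∈ Γ.arc (s 1) (t 1), A⁻¹ ≤ dist ξ ζ)
    (hh : ∀ j, IsSpectrum Γ R (s j) (t j) (g j) (h j))
    (h𝒬 : (𝒬 : Set E3).PairwiseDisjoint fun q => ball q ρ) (hne : 𝒬.Nonempty)
    (hρ : 0 < ρ) (hρR : ρ ≤ R) :
    ∃ q ∈ 𝒬, (∫⁻ x in ball q ρ, ‖g 0 x * g 1 x‖ₑ ^ 2).toReal ≤ 8 * (34 * A ^ 5) ^ 3 *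
      (ρ⁻¹ * (R ^ 2)⁻¹ * ((𝒬.card : ℝ) ^ 2)⁻¹ * 𝒬.card * (‖g 0‖ ^ 2 * ‖g 1‖ ^ 2)) := by
  have hM : (0 : ℝ) < 𝒬.card := Nat.cast_pos.2 hne.card_pos
  have hR0 : 0 < R := by linarith
  have h1 := sum_lintegral_ball_le (ρ := ρ) hΓ hA hst hsep hh h𝒬
  refine Finset.exists_le_of_sum_le hne ?_
  rw [← ENNReal.toReal_sum fun q hq => ((Finset.single_le_sum (fun _ _ => zero_le) hq).trans_lt
    (h1.trans_lt ENNReal.ofReal_lt_top)).ne, Finset.sum_const, nsmul_eq_mul]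
  refine (ENNReal.toReal_le_of_le_ofReal (by positivity) h1).trans ?_
  calc _ = 8 * (34 * A ^ 5) ^ 3 * (R⁻¹ * (R ^ 2)⁻¹ * (‖g 0‖ ^ 2 * ‖g 1‖ ^ 2)) := by
        field_simp
    -- R⁻¹ is weakened to ρ⁻¹ to match the form of the incidence bound.
    _ ≤ 8 * (34 * A ^ 5) ^ 3 * (ρ⁻¹ * (R ^ 2)⁻¹ * (‖g 0‖ ^ 2 * ‖g 1‖ ^ 2)) := by gcongr
    _ = _ := by field_simp

/-- Some ball is met by wave packets of small total energy. -/
theorem exists_ball_le_incidence (hδ : 0 < δ) (hR : 1 ≤ R) (hρ : 1 ≤ ρ)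
    (hρR : ρ ≤ R) (hη : 1 ≤ η) (hne : 𝒬.Nonempty) (hcard : (𝒬.card : ℝ) ≤ R ^ 3)
    {a : Fin 2 → E3 → ℝ} {n : Fin 2 → ℝ} {k k' : ℝ} (hk : 0 ≤ k)
    (ha : ∀ j, ∀ q ∈ 𝒬, 0 ≤ a j q) (hsum : ∀ j, ∑ q ∈ 𝒬, a j q ≤ A * η * (k' * n j ^ 2)) :
    ∃ q ∈ 𝒬, k * (R ^ δ) ^ 4 * (ρ⁻¹ * (R ^ 2)⁻¹) * (a 0 q * a 1 q) +
        k * (R ^ 9)⁻¹ * (n 0 ^ 2 * n 1 ^ 2) ≤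
      (k * (A * k') ^ 2 + k) * (R ^ δ) ^ 4 * (ρ⁻¹ * (R ^ 2)⁻¹ * ((𝒬.card : ℝ) ^ 2)⁻¹ * η ^ 2 *
        (n 0 ^ 2 * n 1 ^ 2)) := by
  have hM : (0 : ℝ) < 𝒬.card := Nat.cast_pos.2 hne.card_pos
  have hR0 : 0 < R := by linarith
  have hRδ : 1 ≤ R ^ δ := Real.one_le_rpow hR hδ.le
  obtain ⟨q, hq, h1⟩ := exists_mul_le_of_sum_le hne (ha 0) (ha 1) (hsum 0) (hsum 1)
  refine ⟨q, hq, ?_⟩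
  -- Since |𝒬| ≤ R³ and ρ ≤ R, the tail R⁻⁹ is absorbed by the main term.
  have h2 : (R ^ 9)⁻¹ ≤ ρ⁻¹ * (R ^ 2)⁻¹ * ((𝒬.card : ℝ) ^ 2)⁻¹ := by
    rw [← mul_inv, ← mul_inv]
    refine inv_anti₀ (by positivity) ?_
    calc ρ * R ^ 2 * (𝒬.card : ℝ) ^ 2 ≤ R * R ^ 2 * (R ^ 3) ^ 2 := by gcongr
      _ = R ^ 9 := by ring
  have h3 : (1 : ℝ) ≤ (R ^ δ) ^ 4 * η ^ 2 := one_le_mul_of_one_le_of_one_le (one_le_pow₀ hRδ)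
    (one_le_pow₀ hη)
  calc _ ≤ k * (R ^ δ) ^ 4 * (ρ⁻¹ * (R ^ 2)⁻¹) * (((𝒬.card : ℝ) ^ 2)⁻¹ *
          (A * η * (k' * n 0 ^ 2) * (A * η * (k' * n 1 ^ 2)))) +
        k * (ρ⁻¹ * (R ^ 2)⁻¹ * ((𝒬.card : ℝ) ^ 2)⁻¹ * ((R ^ δ) ^ 4 * η ^ 2)) *
          (n 0 ^ 2 * n 1 ^ 2) := by
        gcongr
        exact h2.trans (le_mul_of_one_le_right (by positivity) h3)
    _ = _ := by ring

end Assembly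

end PlanarBilinear

open PlanarBilinear in
theorem mainTheorem4 :
    ∃ K : ℝ, 0 < K ∧
    ∀ (W : PlanarBilinear.WavePacketProfile) (D : ℕ → ℝ) (A p δ : ℝ),
      1 ≤ A → 0 < p → p ≤ 4 → 0 < δ →
    ∃ C : ℝ, 0 < C ∧
    ∀ (R ρ η c : ℝ) (x₀ : PlanarBilinear.E3) (Γ : PlanarBilinear.PlanarCurve)
      (s t : Fin 2 → ℝ)
      (g : Fin 2 → Lp ℂ 2 (volume : Measure PlanarBilinear.E3))
      (𝕋 : Fin 2 → Finset PlanarBilinear.TubeIndex)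
      (𝒬 : Finset PlanarBilinear.E3) (F : PlanarBilinear.E3 → ℝ),
      1 ≤ R → R ^ (1 / 2 : ℝ) ≤ ρ → ρ ≤ R → 1 ≤ η →
      -- the curve and its two separated sub-curves
      Γ.IsCurved A →
      (∀ j, Γ.a ≤ s j ∧ s j ≤ t j ∧ t j ≤ Γ.b) →
      (∀ ξ ∈ Γ.arc (s 0) (t 0), ∀ ζ ∈ Γ.arc (s 1) (t 1), A⁻¹ ≤ dist ξ ζ) →
      -- the two functions
      (∀ j, PlanarBilinear.FourierSupportedIn (g j)
        (cthickening R⁻¹ (Γ.arc (s j) (t j)))) →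
      -- the balls and the weights
      PlanarBilinear.IsBallFamily ρ (Γ.slab ρ R c x₀) 𝒬 →
      (∀ q ∈ 𝒬, 0 ≤ F q) →
      (∀ q ∈ 𝒬, ∀ q' ∈ 𝒬, F q ≤ R ^ δ * F q') →
      (∀ q ∈ 𝒬, F q ≤ ∫ x in ball q ρ, ‖g 0 x * g 1 x‖ ^ (p / 2)) →
      -- the wave packet decompositions and their uniform incidence with the balls
      (∀ j, PlanarBilinear.DecomposesOn W Γ ρ R D (Γ.slab ρ R c x₀) (𝕋 j) (g j)) →
      (∀ j, ∀ T ∈ 𝕋 j,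
        A⁻¹ * η ≤ PlanarBilinear.incidence ρ 𝒬
            (PlanarBilinear.tube Γ ρ R δ (Γ.slab ρ R c x₀) T) ∧
        (PlanarBilinear.incidence ρ 𝒬
            (PlanarBilinear.tube Γ ρ R δ (Γ.slab ρ R c x₀) T) : ℝ) ≤ A * η) →
      ∑ q ∈ 𝒬, F q ≤
        C * R ^ (K * δ) * ρ ^ (3 - p) * R ^ (-(p / 2)) * (𝒬.card : ℝ) ^ (1 - p / 2) *
          min ((𝒬.card : ℝ) ^ (p / 4)) (η ^ (p / 2)) *
          ‖g 0‖ ^ (p / 2) * ‖g 1‖ ^ (p / 2) := by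
  refine ⟨5, by norm_num, fun W D A p δ hA hp hp4 hδ => ?_⟩
  obtain ⟨k₁, hk₁, hball⟩ := exists_lintegral_ball_le W D hA hδ
  obtain ⟨k₂, hk₂, henergy⟩ := exists_sum_lintegral_packetFreq_le W
  -- The constants of both alternatives added, so that either bound may be invoked with the same k.
  set k : ℝ := 8 * (34 * A ^ 5) ^ 3 + (k₁ * (A * k₂) ^ 2 + k₁) with hk
  have hk0 : 0 < k := by positivity
  refine ⟨8 ^ (1 - p / 4) * k ^ (p / 4), by positivity, ?_⟩
  intro R ρ η c x₀ Γ s t g 𝕋 𝒬 F hR hρ hρR hη hΓ hst hsep hg h𝒬 hF0 hFF hFg hdec hinc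
  have hR0 : 0 < R := by linarith
  have hρ1 : 1 ≤ ρ := (Real.one_le_rpow hR (by norm_num)).trans hρ
  have hρ0 : 0 < ρ := by linarith
  have hRρ : R ≤ ρ ^ 2 := by
    have := pow_le_pow_left₀ (by positivity) hρ 2
    rwa [← Real.rpow_natCast, ← Real.rpow_mul hR0.le, show (1 / 2 : ℝ) * (2 : ℕ) = 1 by norm_num,
      Real.rpow_one] at this
  rcases 𝒬.eq_empty_or_nonempty with rfl | hne
  · rw [Finset.sum_empty]; positivity
  choose h hh using fun j => exists_isSpectrum hΓ hR (hst j).1 (hst j).2.2 (hg j)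
  have hRδ : 1 ≤ R ^ δ := Real.one_le_rpow hR hδ.le
  have hfin : ∀ q ∈ 𝒬, ∫⁻ x in ball q ρ, ‖g 0 x * g 1 x‖ₑ ^ 2 ≠ ⊤ := fun q hq =>
    ((hball Γ R ρ c x₀ s t g h 𝕋 q hh hΓ hst hsep hR hρ1 hρR hRρ hdec (h𝒬.2 q hq)).trans_lt
      ENNReal.ofReal_lt_top).ne
  have key : ∀ X : ℝ, 0 ≤ X → (∃ q ∈ 𝒬, (∫⁻ x in ball q ρ, ‖g 0 x * g 1 x‖ₑ ^ 2).toReal ≤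
      k * (R ^ δ) ^ 4 * (ρ⁻¹ * (R ^ 2)⁻¹ * ((𝒬.card : ℝ) ^ 2)⁻¹ * X *
        (‖g 0‖ ^ 2 * ‖g 1‖ ^ 2))) →
      ∑ q ∈ 𝒬, F q ≤ (8 ^ (1 - p / 4) * k ^ (p / 4)) * R ^ (5 * δ) * ρ ^ (3 - p) *
        R ^ (-(p / 2)) * (𝒬.card : ℝ) ^ (1 - p / 2) * X ^ (p / 4) *
        ‖g 0‖ ^ (p / 2) * ‖g 1‖ ^ (p / 2) := by
    rintro X hX ⟨q, hq, hGX⟩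
    refine sum_le_of_ball_bound hq hR hρ0 hp hp4 hδ hk0.le hX (norm_nonneg _) (norm_nonneg _)
      ENNReal.toReal_nonneg (fun q' hq' => hFF q' hq' q hq) ((hFg q hq).trans ?_) hGX
    exact integral_ball_rpow_le ((Lp.aestronglyMeasurable _).mul (Lp.aestronglyMeasurable _))
      hρ0 hp hp4 (hfin q hq)
  -- Only the bound for the smaller of the two terms has to be proved.
  rcases min_choice ((𝒬.card : ℝ) ^ (p / 4)) (η ^ (p / 2)) with e | e <;> rw [e]
  · refine key _ (Nat.cast_nonneg _) ?_
    obtain ⟨q, hq, hle⟩ := exists_ball_le_average hΓ hA hst hsep hh h𝒬.1 hne hρ0 hρR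
    refine ⟨q, hq, hle.trans ?_⟩
    refine mul_le_mul_of_nonneg_right ?_ (by positivity)
    calc 8 * (34 * A ^ 5) ^ 3 ≤ k := le_add_of_nonneg_right (by positivity)
      _ ≤ k * (R ^ δ) ^ 4 := le_mul_of_one_le_right hk0.le (one_le_pow₀ hRδ)
  -- The second alternative is the choice X = η².
  · rw [show η ^ (p / 2) = (η ^ 2) ^ (p / 4) by
      rw [← Real.rpow_natCast, ← Real.rpow_mul (by linarith)]; congr 1; push_cast; ring]
    refine key _ (by positivity) ?_
    have hsum : ∀ j, ∑ q ∈ 𝒬, ∑ T ∈ tubesMeeting Γ ρ R δ (Γ.slab ρ R c x₀) (𝕋 j) q,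
        packetEnergy W Γ ρ (h j) T ≤ A * η * (k₂ * ‖g j‖ ^ 2) := fun j => by
      refine (sum_sum_tubesMeeting_le (packetEnergy_nonneg W Γ ρ (h j))
        fun T hT => (hinc j T hT).2).trans ?_
      gcongr
      have := henergy Γ ρ (h j) (hh j).measurable (hh j).integrable (hh j).memLp (𝕋 j)
      rwa [(hh j).sum_lintegral_eq, (hh j).lintegral_sq, ← ENNReal.ofReal_mul hk₂,
        ENNReal.ofReal_le_ofReal_iff (by positivity)] at this
    obtain ⟨q, hq, hle⟩ := exists_ball_le_incidence hδ hR hρ1 hρR hη hne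
      (card_ballFamily_le hR0 hρ1 h𝒬) hk₁
      (fun j q _ => Finset.sum_nonneg fun T _ => packetEnergy_nonneg W Γ ρ (h j) T) hsum
    refine ⟨q, hq, (ENNReal.toReal_le_of_le_ofReal ?_ (hball Γ R ρ c x₀ s t g h 𝕋 q hh hΓ hst
      hsep hR hρ1 hρR hRρ hdec (h𝒬.2 q hq))).trans (hle.trans ?_)⟩
    · have : ∀ j, 0 ≤ ∑ T ∈ tubesMeeting Γ ρ R δ (Γ.slab ρ R c x₀) (𝕋 j) q,
          packetEnergy W Γ ρ (h j) T := fun j =>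
        Finset.sum_nonneg fun T _ => packetEnergy_nonneg W Γ ρ (h j) T
      have := mul_nonneg (this 0) (this 1)
      positivity
    · gcongr
      exact le_add_of_nonneg_left (by positivity)
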